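/- **Lemma.** Let $n\ge 2$, $q\ge 0$, $p<-n-q+1$, $c_0\ge 1$ and $A\in\mathbb R$. There are constants $\delta,v_0,v_1,\bar e>0$, depending only on $n,p,q,c_0$ and $A$, with the following property. Let $f:\mathbb S^{n-1}\to\mathbb R$ be measurable with $1/c_0\le f\le c_0$ almost everywhere, and let $\Omega\subset\mathbb R^n$ be a compact convex set with $0$ in its interior which satisfies at least one of (i) $\operatorname{dist}(0,\partial\Omega)\in(0,\delta)$; (ii) $\operatorname{Vol}(\Omega)\ge v_1$; (iii) $\operatorname{Vol}(\Omega)\le v_0$; (iv) $e_\Omega\ge\bar e$. Then $$\mathcal J(\Omega):=I_q(\Omega)-\frac1p\int_{\mathbb S^{n-1}} f\,h^p\,d\sigma_{\mathbb S^{n-1}}>A .$$ Here $h(v)=\max\{v\cdot x: x\in\Omega\}$ is the support function of $\Omega$; $\sigma_{\mathbb S^{n-1}}$ is the surface measure of the unit sphere; $I_q(\Omega)=\int|\Omega\cap\ell|^q\,d\ell$ is the chord integral, taken over the lines $\ell$ of $\mathbb R^n$ that meet $\Omega$, where $|\Omega\cap\ell|$ is the length of the chord and $d\ell$ is the rigid-motion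 invariant measure on lines, normalized to be a probability measure on directions and $(n-1)$-dimensional Lebesgue measure on parallel translations; and $e_\Omega$ is the ratio of the largest to the smallest semi-axis of the minimum ellipsoid of $\Omega$, i.e. of the ellipsoid of least volume containing $\Omega$. -/

import Mathlib

open MeasureTheory Set Metric
open scoped ENNReal

noncomputable section

namespace ChordMinkowski

/-- The surface measure of the unit sphere of `ℝⁿ` (its total mass is `n ωₙ`). -/
abbrev sphereMeasure (n : ℕ) : Measure (sphere (0 : EuclideanSpace ℝ (Fin n)) 1) :=
  (volume : Measure (EuclideanSpace ℝ (Fin n))).toSphere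

/-- The line through `x` in direction `u` (for `u ≠ 0`). -/
def line {n : ℕ} (u x : EuclideanSpace ℝ (Fin n)) : AffineSubspace ℝ (EuclideanSpace ℝ (Fin n)) :=
  AffineSubspace.mk' x (Submodule.span ℝ {u})

/-- Integration over the affine Grassmannian of lines of `ℝⁿ` with respect to the rigid-motion
invariant measure, normalized to be a probability measure on directions and the
`(n-1)`-dimensional Lebesgue measure (`volume` on the hyperplane `u^⊥`) on the parallel
translations of a line of direction `u`. -/
def lintegralLines {n : ℕ}
    (F : AffineSubspace ℝ (EuclideanSpace ℝ (Fin n)) → ℝ≥0∞) : ℝ≥0∞ :=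
  (sphereMeasure n univ)⁻¹ *
    ∫⁻ u : sphere (0 : EuclideanSpace ℝ (Fin n)) 1,
      ∫⁻ x : ((Submodule.span ℝ {(u : EuclideanSpace ℝ (Fin n))})ᗮ :
          Submodule ℝ (EuclideanSpace ℝ (Fin n))),
        F (line u x) ∂volume ∂(sphereMeasure n)

open Classical in
/-- The chord integral `I_q(K)`: the integral of `|K ∩ ℓ|^q` over the lines `ℓ` that meet `K`,
where `|K ∩ ℓ|` is the length. (Lines that miss `K` matter only for the reading of `0^q`
at `q = 0`.) -/
def chordIntegral {n : ℕ} (q : ℝ) (K : Set (EuclideanSpace ℝ (Fin n))) : ℝ≥0∞ :=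
  lintegralLines fun (ℓ : AffineSubspace ℝ (EuclideanSpace ℝ (Fin n))) =>
    if (K ∩ (ℓ : Set (EuclideanSpace ℝ (Fin n)))).Nonempty then
      (μH[1] (K ∩ (ℓ : Set (EuclideanSpace ℝ (Fin n))))) ^ q
    else 0

theorem volume_closedBall_orthogonal {n : ℕ} (hn : 2 ≤ n) (u : sphere (0 : EuclideanSpace ℝ (Fin n)) 1) (R : ℝ) : 
  volume (closedBall (0 : ((Submodule.span ℝ {(u : EuclideanSpace ℝ (Fin n))})ᗮ :
          Submodule ℝ (EuclideanSpace ℝ (Fin n)))) R) = 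
   ENNReal.ofReal R ^ (n-1) * ENNReal.ofReal (√Real.pi ^ (n-1) / Real.Gamma ((n-1:ℕ) / 2 + 1)) := by
  have hf : Module.finrank ℝ ((Submodule.span ℝ {(u : EuclideanSpace ℝ (Fin n))})ᗮ :
          Submodule ℝ (EuclideanSpace ℝ (Fin n))) = n - 1 := by
    have h1 : Module.finrank ℝ (Submodule.span ℝ {(u : EuclideanSpace ℝ (Fin n))}) = 1 :=
      finrank_span_singleton (ne_zero_of_mem_unit_sphere u)
    have := (Submodule.span ℝ {(u : EuclideanSpace ℝ (Fin n))}).finrank_add_finrank_orthogonal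
    simp at this h1
    omega
  have : Nontrivial ((Submodule.span ℝ {(u : EuclideanSpace ℝ (Fin n))})ᗮ :
          Submodule ℝ (EuclideanSpace ℝ (Fin n))) := by
    apply Module.nontrivial_of_finrank_pos (R := ℝ); omega
  rw [InnerProductSpace.volume_closedBall, hf]

/-- The length of `K ∩ ℓ` in an arc-length parametrization of `ℓ`. -/
theorem hausdorffMeasure_inter_line {n : ℕ} (u : EuclideanSpace ℝ (Fin n)) (hu : ‖u‖ = 1) (x : EuclideanSpace ℝ (Fin n)) (K : Set (EuclideanSpace ℝ (Fin n))) :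
   μH[1] (K ∩ (line u x : Set (EuclideanSpace ℝ (Fin n)))) = volume {t : ℝ | x + t • u ∈ K} := by
  have hi : Isometry (fun t : ℝ => x + t • u) := by
    apply Isometry.of_dist_eq
    intro a b
    simp [dist_eq_norm, ← sub_smul, norm_smul, hu]
  have : K ∩ (line u x : Set (EuclideanSpace ℝ (Fin n))) = (fun t : ℝ => x + t • u) '' {t : ℝ | x + t • u ∈ K} := by
    ext y
    simp only [line, Set.mem_inter_iff, SetLike.mem_coe, AffineSubspace.mem_mk', Submodule.mem_span_singleton, Set.mem_image, Set.mem_ofPred_eq]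
    constructor
    · rintro ⟨h, t, ht⟩
      have : x + t • u = y := by rw [ht]; simp
      exact ⟨t, by rwa [this], this⟩
    · rintro ⟨t, h, rfl⟩
      exact ⟨h, t, by simp⟩
  rw [this, hi.hausdorffMeasure_image (Or.inl zero_le_one), hausdorffMeasure_real]

/-- For `q ≥ 0` the chord integral of a bounded set is finite, so that its `toReal` in
`functionalJ` loses nothing. -/
theorem chordIntegral_lt_top {n : ℕ} (hn : 2 ≤ n) {q : ℝ} (hq : 0 ≤ q)
    {K : Set (EuclideanSpace ℝ (Fin n))} (hK : Bornology.IsBounded K) : chordIntegral q K < ∞ := by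
  obtain ⟨R, hR0, hR⟩ : ∃ R : ℝ, 0 < R ∧ ∀ x ∈ K, ‖x‖ ≤ R := hK.exists_pos_norm_le
  have key : ∀ (u : sphere (0 : EuclideanSpace ℝ (Fin n)) 1)
      (x : ((Submodule.span ℝ {(u : EuclideanSpace ℝ (Fin n))})ᗮ : Submodule ℝ (EuclideanSpace ℝ (Fin n)))) (t : ℝ),
      (x : EuclideanSpace ℝ (Fin n)) + t • (u : EuclideanSpace ℝ (Fin n)) ∈ K → ‖x‖ ≤ R ∧ |t| ≤ R := by
    intro u x t h
    have hu : ‖(u : EuclideanSpace ℝ (Fin n))‖ = 1 := by simp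
    have h0 : inner ℝ (x : EuclideanSpace ℝ (Fin n)) (t • (u : EuclideanSpace ℝ (Fin n))) = 0 := by
      rw [inner_smul_right, (Submodule.mem_orthogonal' _ _).1 x.2 u (Submodule.mem_span_singleton_self _), mul_zero]
    have h1 := norm_add_sq_eq_norm_sq_add_norm_sq_of_inner_eq_zero _ _ h0
    rw [norm_smul, hu, mul_one, Real.norm_eq_abs] at h1
    have h2 := hR _ h
    have h3 := norm_nonneg ((x : EuclideanSpace ℝ (Fin n)) + t • (u : EuclideanSpace ℝ (Fin n)))
    have h4 : ‖(x : EuclideanSpace ℝ (Fin n))‖ = ‖x‖ := rfl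
    rw [h4] at h1
    have h6 := mul_le_mul h2 h2 h3 hR0.le
    constructor
    · apply abs_le_of_sq_le_sq' _ hR0.le |>.2
      nlinarith [abs_nonneg t]
    · apply abs_le_of_sq_le_sq' _ hR0.le |>.2
      nlinarith [norm_nonneg x]
  have hσ : sphereMeasure n univ ≠ ∞ := measure_ne_top _ _
  set C : ℝ≥0∞ := ENNReal.ofReal (2 * R) ^ q * (ENNReal.ofReal R ^ (n-1) * ENNReal.ofReal (√Real.pi ^ (n-1) / Real.Gamma ((n-1:ℕ) / 2 + 1))) with hC
  have hCt : C ≠ ∞ := by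
    apply ENNReal.mul_ne_top (ENNReal.rpow_ne_top_of_nonneg hq ENNReal.ofReal_ne_top)
    exact ENNReal.mul_ne_top (by finiteness) (by finiteness)
  have hb : chordIntegral q K ≤ (sphereMeasure n univ)⁻¹ * (C * sphereMeasure n univ) := by
    unfold chordIntegral lintegralLines
    gcongr
    rw [← lintegral_const]
    apply lintegral_mono
    intro u
    rw [hC, ← volume_closedBall_orthogonal hn u R, ← setLIntegral_const, ← lintegral_indicator measurableSet_closedBall]
    apply lintegral_mono
    intro x
    dsimp only
    have hu : ‖(u : EuclideanSpace ℝ (Fin n))‖ = 1 := by simp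
    split_ifs with h
    · rw [hausdorffMeasure_inter_line _ hu]
      obtain ⟨y, hy, hy'⟩ := h
      obtain ⟨t, ht⟩ := Submodule.mem_span_singleton.1 (AffineSubspace.mem_mk'.1 hy')
      have hyt : (x : EuclideanSpace ℝ (Fin n)) + t • (u : EuclideanSpace ℝ (Fin n)) = y := by rw [ht]; simp
      have hx := key u x t (hyt ▸ hy)
      rw [Set.indicator_of_mem (by simpa using hx.1)]
      refine ENNReal.rpow_le_rpow ?_ hq
      calc volume {t : ℝ | (x : EuclideanSpace ℝ (Fin n)) + t • (u : EuclideanSpace ℝ (Fin n)) ∈ K} ≤ volume (Icc (-R) R) :=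
            measure_mono fun t ht => abs_le.1 (key u x t ht).2
        _ = _ := by rw [Real.volume_Icc]; congr 1; ring
    · simp
  refine hb.trans_lt ?_
  have h5 : sphereMeasure n univ ≠ 0 := by
    have : Nontrivial (EuclideanSpace ℝ (Fin n)) := by
      apply Module.nontrivial_of_finrank_pos (R := ℝ); simp; omega
    rw [Ne, Measure.measure_univ_eq_zero]; exact Measure.toSphere_ne_zero _
  exact ENNReal.mul_lt_top (by simpa [pos_iff_ne_zero] using h5) (ENNReal.mul_lt_top hCt.lt_top hσ.lt_top)

/-- The support function `h_K(v) = max {v · x : x ∈ K}`. -/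
def supportFunction {n : ℕ} (K : Set (EuclideanSpace ℝ (Fin n)))
    (v : EuclideanSpace ℝ (Fin n)) : ℝ :=
  sSup ((fun x => inner ℝ v x) '' K)

/-- The functional `J(Ω) = I_q(Ω) - (1/p) ∫ f h^p dσ`. -/
def functionalJ {n : ℕ} (p q : ℝ) (f : sphere (0 : EuclideanSpace ℝ (Fin n)) 1 → ℝ)
    (Ω : Set (EuclideanSpace ℝ (Fin n))) : ℝ :=
  (chordIntegral q Ω).toReal -
    (1 / p) * ∫ u, f u * supportFunction Ω (u : EuclideanSpace ℝ (Fin n)) ^ p ∂(sphereMeasure n)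

/-- The data of a nondegenerate ellipsoid of `ℝⁿ`: a center, an orthonormal frame of principal
directions, and positive semi-axes. -/
structure Ellipsoid (n : ℕ) where
  center : EuclideanSpace ℝ (Fin n)
  axes : OrthonormalBasis (Fin n) ℝ (EuclideanSpace ℝ (Fin n))
  semiaxis : Fin n → ℝ
  semiaxis_pos : ∀ i, 0 < semiaxis i

namespace Ellipsoid

/-- The solid ellipsoid. -/
def toSet {n : ℕ} (E : Ellipsoid n) : Set (EuclideanSpace ℝ (Fin n)) :=
  {z | ∑ i, (inner ℝ (E.axes i) (z - E.center)) ^ 2 / E.semiaxis i ^ 2 ≤ 1}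

/-- The ratio of the largest to the smallest semi-axis. -/
def eccentricity {n : ℕ} (E : Ellipsoid n) : ℝ :=
  (⨆ i, E.semiaxis i) / (⨅ i, E.semiaxis i)

/-- `E` is an ellipsoid of least volume containing `Ω`. -/
def IsMinimum {n : ℕ} (E : Ellipsoid n) (Ω : Set (EuclideanSpace ℝ (Fin n))) : Prop :=
  Ω ⊆ E.toSet ∧ ∀ E' : Ellipsoid n, Ω ⊆ E'.toSet → volume E.toSet ≤ volume E'.toSet

end Ellipsoid

/-- The eccentricity `e_Ω` of a convex body: the eccentricity of its minimum ellipsoid. A convex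
body has exactly one minimum ellipsoid, so that the set below is a singleton and `sSup` returns
its element. -/
def eccentricity {n : ℕ} (Ω : Set (EuclideanSpace ℝ (Fin n))) : ℝ :=
  sSup {e : ℝ | ∃ E : Ellipsoid n, E.IsMinimum Ω ∧ e = E.eccentricity}

end ChordMinkowski

end

/-! Suppose the functional is at most A. Since p < 0, both of its terms are nonnegative, so both are
bounded. This confines Ω between two balls and keeps the origin away from the boundary
(`exists_confinement`), so each of the four alternatives fails for suitable constants.

The size of Ω is read off a frame w₁, …, wₙ ∈ Ω that maximizes |det|: Ω contains the simplex with
vertices 0, wᵢ and lies in the parallelepiped of all Σ tᵢwᵢ with |tᵢ| ≤ 1. Let D = |det w|, l = max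
‖wᵢ‖, and let r be the minimum of Σ |⟨wᵢ, v⟩| over unit vectors v (`exists_frame_bounds`). Up to
constants, three estimates hold. (a) Ω contains a ball of radius ~ r, lies in a slab of width ~ r
and has volume ≳ D, whence I_q ≳ r^(q-1) D (`exists_le_chordIntegral`). (b) h ≲ r on a set of
directions of measure ≳ rⁿ/D, whence ∫ f h^p ≳ r^(p+n)/D (`le_integral_supportFunction`). (c) l
r^(n-1) ≲ D (`norm_mul_pow_le`). By (a) and (b), r^(p+n+q-1) is bounded; the hypothesis on p says
that this exponent is negative, so r is bounded below. Then (a) and (c) give l ≲ r^(2-n-q), which is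
bounded because n ≥ 2 and q ≥ 0 (`exists_radii`).

Once Ω lies in a fixed ball, a boundary point at distance < δ from the origin forces h ≲ δ on a cap
of radius ~ δ. The integral term is then ≳ δ^(p+n-1), again with a negative exponent
(`exists_lt_integral_of_infDist`). -/

namespace ChordMinkowski

/-! ### Fubini along a direction, cones and cylinders -/

/-- `ℝⁿ` as a product of a hyperplane `u^⊥` and the line spanned by the unit vector `u`. -/
theorem measurePreserving_orthogonal_prod {n : ℕ} (u : EuclideanSpace ℝ (Fin n)) (hu : ‖u‖ = 1) :
    MeasurePreserving (fun z : ((Submodule.span ℝ {u})ᗮ :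
      Submodule ℝ (EuclideanSpace ℝ (Fin n))) × ℝ => (z.1 : EuclideanSpace ℝ (Fin n)) + z.2 • u)
      volume volume := by
  have h1 : MeasurePreserving (fun z : ((Submodule.span ℝ {u})ᗮ :
      Submodule ℝ (EuclideanSpace ℝ (Fin n))) × ℝ =>
      (z.2, z.1)) volume volume := Measure.measurePreserving_swap
  have h2 : MeasurePreserving (Prod.map (LinearIsometryEquiv.toSpanUnitSingleton (𝕜 := ℝ) u hu)
      (id : ((Submodule.span ℝ {u})ᗮ : Submodule ℝ (EuclideanSpace ℝ (Fin n))) → _))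
      volume volume :=
    (LinearIsometryEquiv.measurePreserving _).prod (MeasurePreserving.id _)
  have h3 := WithLp.volume_preserving_toLp (Submodule.span ℝ {u})
    ((Submodule.span ℝ {u})ᗮ : Submodule ℝ (EuclideanSpace ℝ (Fin n)))
  have h4 := (Submodule.span ℝ {u}).orthogonalDecomposition.symm.measurePreserving
  have h5 := h4.comp (h3.comp (h2.comp h1))
  have h6 : (fun z : ((Submodule.span ℝ {u})ᗮ : Submodule ℝ (EuclideanSpace ℝ (Fin n))) × ℝ =>
      (z.1 : EuclideanSpace ℝ (Fin n)) + z.2 • u) =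
      (Submodule.span ℝ {u}).orthogonalDecomposition.symm ∘
        WithLp.toLp 2 ∘ Prod.map (LinearIsometryEquiv.toSpanUnitSingleton u hu) id ∘
        fun z => (z.2, z.1) := by
    funext z
    simp [add_comm]
  rw [h6]
  exact h5

theorem volume_eq_lintegral_orthogonal {n : ℕ} (u : EuclideanSpace ℝ (Fin n)) (hu : ‖u‖ = 1)
    {s : Set (EuclideanSpace ℝ (Fin n))} (hs : MeasurableSet s) :
    volume s = ∫⁻ x : ((Submodule.span ℝ {u})ᗮ : Submodule ℝ (EuclideanSpace ℝ (Fin n))),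
      volume {t : ℝ | (x : EuclideanSpace ℝ (Fin n)) + t • u ∈ s} := by
  have h := measurePreserving_orthogonal_prod u hu
  rw [← h.measure_preimage hs.nullMeasurableSet, Measure.volume_eq_prod,
    Measure.prod_apply (h.measurable hs)]
  rfl

/-- Lower bound for the surface measure by the volume of a piece of the cone. -/
theorem le_toSphere {n : ℕ} {V : Set (sphere (0 : EuclideanSpace ℝ (Fin n)) 1)}
    (hV : MeasurableSet V) {W : Set (EuclideanSpace ℝ (Fin n))}
    (hW : ∀ x ∈ W, ‖x‖ < 1 ∧ ∃ v ∈ V, ∃ t : ℝ, 0 < t ∧ x = t • (v : EuclideanSpace ℝ (Fin n))) :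
    n * volume W ≤ sphereMeasure n V := by
  rw [Measure.toSphere_apply' _ hV, finrank_euclideanSpace_fin]
  gcongr
  intro x hx
  obtain ⟨h1, v, hv, t, ht, rfl⟩ := hW x hx
  refine Set.smul_mem_smul ⟨ht, ?_⟩ (mem_image_of_mem _ hv)
  simpa [norm_smul, abs_of_pos ht] using h1

/-- The volume of the unit ball of dimension `n - 1`. -/
noncomputable def hyperplaneBallVolume (n : ℕ) : ℝ := √Real.pi ^ (n - 1) / Real.Gamma ((n - 1 : ℕ) / 2 + 1)

theorem hyperplaneBallVolume_pos (n : ℕ) : 0 < hyperplaneBallVolume n := by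
  unfold hyperplaneBallVolume
  have : 0 < Real.Gamma ((n - 1 : ℕ) / 2 + 1) := Real.Gamma_pos_of_pos (by positivity)
  have := Real.pi_pos
  positivity

/-- Volume of a cylinder over a ball in `u^⊥`. -/
theorem volume_cylinder {n : ℕ} (hn : 2 ≤ n) (u : EuclideanSpace ℝ (Fin n)) (hu : ‖u‖ = 1)
    (a b R : ℝ) :
    volume ((fun z : ((Submodule.span ℝ {u})ᗮ : Submodule ℝ (EuclideanSpace ℝ (Fin n))) × ℝ =>
      (z.1 : EuclideanSpace ℝ (Fin n)) + z.2 • u) '' (closedBall 0 R ×ˢ Icc a b)) =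
    ENNReal.ofReal R ^ (n - 1) * ENNReal.ofReal (hyperplaneBallVolume n) * ENNReal.ofReal (b - a) := by
  have h := measurePreserving_orthogonal_prod u hu
  have hu0 : u ≠ 0 := by rintro rfl; simp at hu
  have hinj : Function.Injective (fun z : ((Submodule.span ℝ {u})ᗮ :
      Submodule ℝ (EuclideanSpace ℝ (Fin n))) × ℝ =>
        (z.1 : EuclideanSpace ℝ (Fin n)) + z.2 • u) := by
    rintro ⟨x, s⟩ ⟨y, t⟩ hxy
    have key : ∀ z : ((Submodule.span ℝ {u})ᗮ : Submodule ℝ (EuclideanSpace ℝ (Fin n))),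
        inner ℝ u (z : EuclideanSpace ℝ (Fin n)) = 0 := fun z =>
      (Submodule.mem_orthogonal _ _).1 z.2 u (Submodule.mem_span_singleton_self _)
    have h1 := congrArg (fun w => inner ℝ u w) hxy
    simp only [inner_add_right, key, inner_smul_right, real_inner_self_eq_norm_sq, hu] at h1
    have h2 : s = t := by simpa using h1
    subst h2
    simpa using hxy
  have hc : IsCompact ((fun z : ((Submodule.span ℝ {u})ᗮ :
      Submodule ℝ (EuclideanSpace ℝ (Fin n))) × ℝ =>
        (z.1 : EuclideanSpace ℝ (Fin n)) + z.2 • u) '' (closedBall 0 R ×ˢ Icc a b)) :=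
    ((isCompact_closedBall _ _).prod isCompact_Icc).image (by fun_prop)
  rw [← h.measure_preimage hc.measurableSet.nullMeasurableSet, preimage_image_eq _ hinj,
    Measure.volume_eq_prod, Measure.prod_prod, Real.volume_Icc]
  congr 1
  exact volume_closedBall_orthogonal hn ⟨u, by simpa using hu⟩ R

/-! ### The support function and the integral term -/

section SupportFunction

variable {n : ℕ} {K : Set (EuclideanSpace ℝ (Fin n))} {R : ℝ}

theorem supportFunction_le (hne : K.Nonempty) {v : EuclideanSpace ℝ (Fin n)} {M : ℝ}
    (h : ∀ y ∈ K, inner ℝ v y ≤ M) : supportFunction K v ≤ M := by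
  refine csSup_le (hne.image _) ?_
  rintro _ ⟨y, hy, rfl⟩
  exact h y hy

theorem inner_le_supportFunction (hR : ∀ x ∈ K, ‖x‖ ≤ R) (v : EuclideanSpace ℝ (Fin n))
    {y : EuclideanSpace ℝ (Fin n)} (hy : y ∈ K) : inner ℝ v y ≤ supportFunction K v := by
  refine le_csSup ⟨‖v‖ * R, ?_⟩ (mem_image_of_mem _ hy)
  rintro _ ⟨x, hx, rfl⟩
  exact (real_inner_le_norm v x).trans (by gcongr; exact hR x hx)

theorem continuous_supportFunction (hne : K.Nonempty) (hR0 : 0 ≤ R) (hR : ∀ x ∈ K, ‖x‖ ≤ R) :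
    Continuous (supportFunction K) := by
  refine (LipschitzWith.of_le_add_mul R.toNNReal fun v w => ?_).continuous
  rw [Real.coe_toNNReal _ hR0]
  refine supportFunction_le hne fun y hy => ?_
  have h1 : inner ℝ v y = inner ℝ w y + inner ℝ (v - w) y := by rw [inner_sub_left]; ring
  rw [h1]
  gcongr
  · exact inner_le_supportFunction hR w hy
  · rw [dist_eq_norm, mul_comm]
    exact (real_inner_le_norm _ _).trans (by gcongr; exact hR y hy)

theorem supportFunction_pos (hR : ∀ x ∈ K, ‖x‖ ≤ R) (h0 : 0 ∈ interior K)
    {v : EuclideanSpace ℝ (Fin n)} (hv : ‖v‖ = 1) : 0 < supportFunction K v := by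
  obtain ⟨ε, hε, h⟩ := Metric.isOpen_iff.1 isOpen_interior 0 h0
  have h1 : (ε / 2) • v ∈ K := by
    refine interior_subset (h ?_)
    simp [norm_smul, hv, abs_of_pos hε]
    linarith
  have h2 := inner_le_supportFunction hR v h1
  rw [inner_smul_right, real_inner_self_eq_norm_sq, hv] at h2
  linarith

end SupportFunction

/-- Spherical measure is n times the volume of the cone, so a solid set W in the shell 1/2 ≤ ‖x‖ < 1
can stand for a set of directions. Normalizing a point of W at most doubles the bound M, and t ↦ t^p
is nonincreasing. -/
theorem le_integral_supportFunction {n : ℕ} {K : Set (EuclideanSpace ℝ (Fin n))}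
    {R p c₀ M : ℝ} (hR : ∀ x ∈ K, ‖x‖ ≤ R) (h0 : 0 ∈ interior K) (hp : p ≤ 0) (hc₀ : 0 < c₀)
    (hM : 0 < M) {f : sphere (0 : EuclideanSpace ℝ (Fin n)) 1 → ℝ} (hf : AEMeasurable f (sphereMeasure n))
    (hfb : ∀ᵐ u ∂(sphereMeasure n), 1 / c₀ ≤ f u ∧ f u ≤ c₀)
    {W : Set (EuclideanSpace ℝ (Fin n))}
    (hW : ∀ x ∈ W, 1 / 2 ≤ ‖x‖ ∧ ‖x‖ < 1 ∧ ∀ y ∈ K, inner ℝ x y ≤ M) :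
    1 / c₀ * (2 * M) ^ p * (n * (volume W).toReal) ≤
      ∫ u, f u * supportFunction K (u : EuclideanSpace ℝ (Fin n)) ^ p ∂(sphereMeasure n) := by
  have hne : K.Nonempty := ⟨0, interior_subset h0⟩
  have hR0 : 0 ≤ R := by simpa using hR 0 (interior_subset h0)
  have hcont : Continuous fun u : sphere (0 : EuclideanSpace ℝ (Fin n)) 1 =>
      supportFunction K (u : EuclideanSpace ℝ (Fin n)) :=
    (continuous_supportFunction hne hR0 hR).comp continuous_subtype_val
  have hpos : ∀ u : sphere (0 : EuclideanSpace ℝ (Fin n)) 1,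
      0 < supportFunction K (u : EuclideanSpace ℝ (Fin n)) := fun u =>
    supportFunction_pos hR h0 (by simp)
  have hcp : Continuous fun u : sphere (0 : EuclideanSpace ℝ (Fin n)) 1 =>
      supportFunction K (u : EuclideanSpace ℝ (Fin n)) ^ p :=
    hcont.rpow_const fun u => Or.inl (hpos u).ne'
  -- Integrability is essential: the Bochner integral of a non-integrable function is 0, which would
  -- spoil a lower bound. Here h is continuous and positive on a compact sphere, so h^p is bounded.
  obtain ⟨C, hC⟩ := isCompact_univ.exists_bound_of_continuousOn hcp.continuousOn
  have hfi : Integrable f (sphereMeasure n) := by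
    refine Integrable.of_bound hf.aestronglyMeasurable c₀ ?_
    filter_upwards [hfb] with u hu
    rw [Real.norm_eq_abs, abs_le]
    have := one_div_pos.2 hc₀
    constructor <;> linarith [hu.1, hu.2]
  have hint : Integrable (fun u => f u * supportFunction K (u : EuclideanSpace ℝ (Fin n)) ^ p)
      (sphereMeasure n) :=
    hfi.mul_bdd hcp.aestronglyMeasurable (Filter.Eventually.of_forall fun u => hC u (mem_univ u))
  set V : Set (sphere (0 : EuclideanSpace ℝ (Fin n)) 1) :=
    {v | supportFunction K (v : EuclideanSpace ℝ (Fin n)) ≤ 2 * M} with hVdef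
  have hV : MeasurableSet V := (isClosed_le hcont continuous_const).measurableSet
  have hWV : n * volume W ≤ sphereMeasure n V := by
    refine le_toSphere hV fun x hx => ⟨(hW x hx).2.1, ?_⟩
    obtain ⟨h1, -, h2⟩ := hW x hx
    have hx0 : 0 < ‖x‖ := by linarith
    refine ⟨⟨‖x‖⁻¹ • x, by simp [norm_smul, hx0.ne']⟩, ?_, ‖x‖, hx0, by simp [smul_smul, hx0.ne']⟩
    refine supportFunction_le hne fun y hy => ?_
    simp only [inner_smul_left, RCLike.conj_to_real]
    calc ‖x‖⁻¹ * inner ℝ x y ≤ ‖x‖⁻¹ * M := by gcongr; exact h2 y hy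
      _ ≤ 2 * M := by
        gcongr
        rw [inv_le_comm₀ hx0 two_pos]
        linarith
  have hWV' : n * (volume W).toReal ≤ (sphereMeasure n).real V := by
    have := ENNReal.toReal_mono (measure_ne_top _ _) hWV
    simpa [Measure.real] using this
  calc 1 / c₀ * (2 * M) ^ p * (n * (volume W).toReal)
      ≤ 1 / c₀ * (2 * M) ^ p * (sphereMeasure n).real V := by gcongr
    _ = ∫ u, V.indicator (fun _ => 1 / c₀ * (2 * M) ^ p) u ∂(sphereMeasure n) := by
      rw [integral_indicator_const _ hV, smul_eq_mul, mul_comm]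
    _ ≤ _ := by
      refine integral_mono_ae ((integrable_const _).indicator hV) hint ?_
      filter_upwards [hfb] with u hu
      have h1 := one_div_pos.2 hc₀
      have h2 := Real.rpow_nonneg (hpos u).le p
      by_cases huV : u ∈ V
      · rw [indicator_of_mem huV]
        exact mul_le_mul hu.1 (Real.rpow_le_rpow_of_nonpos (hpos u) huV hp) (by positivity)
          (by linarith [hu.1])
      · rw [indicator_of_notMem huV]
        exact mul_nonneg (by linarith [hu.1]) h2

/-! ### Lower bounds for the chord integral -/

/-- A lower bound for the chord integral through the lines of direction `u`, when the chords of
direction `u` have length at most `L`. -/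
theorem le_lintegral_chords {n : ℕ} {q ρ : ℝ} (hq : 0 ≤ q)
    {K : Set (EuclideanSpace ℝ (Fin n))} (hK : IsCompact K) (hKc : Convex ℝ K)
    {z : EuclideanSpace ℝ (Fin n)} (hz : closedBall z ρ ⊆ K) (hρ : 0 < ρ)
    (u : sphere (0 : EuclideanSpace ℝ (Fin n)) 1) {L : ℝ≥0∞}
    (hL : ∀ x, volume {t : ℝ | x + t • (u : EuclideanSpace ℝ (Fin n)) ∈ K} ≤ L) :
    ENNReal.ofReal ρ ^ q * (ENNReal.ofReal ((1 / 2) ^ n) * (volume K / L)) ≤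
      ∫⁻ x : ((Submodule.span ℝ {(u : EuclideanSpace ℝ (Fin n))})ᗮ :
          Submodule ℝ (EuclideanSpace ℝ (Fin n))),
        (open Classical in
        if (K ∩ (line (u : EuclideanSpace ℝ (Fin n)) x : Set (EuclideanSpace ℝ (Fin n)))).Nonempty
        then (μH[1] (K ∩ (line (u : EuclideanSpace ℝ (Fin n)) x :
          Set (EuclideanSpace ℝ (Fin n))))) ^ q else 0) := by
  have hu : ‖(u : EuclideanSpace ℝ (Fin n))‖ = 1 := by simp
  set S : Submodule ℝ (EuclideanSpace ℝ (Fin n)) :=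
    (Submodule.span ℝ {(u : EuclideanSpace ℝ (Fin n))})ᗮ with hS
  set π : EuclideanSpace ℝ (Fin n) →L[ℝ] S := S.orthogonalProjectionOnto with hπ
  have hdec : ∀ y, ∃ t : ℝ, y = (π y : EuclideanSpace ℝ (Fin n)) +
      t • (u : EuclideanSpace ℝ (Fin n)) := by
    intro y
    have h1 : y - π y ∈ Sᗮ := Submodule.sub_starProjection_mem_orthogonal y
    have h2 : Sᗮ = Submodule.span ℝ {(u : EuclideanSpace ℝ (Fin n))} :=
      Submodule.orthogonal_orthogonal _
    obtain ⟨t, ht⟩ := Submodule.mem_span_singleton.1 (h2.le h1)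
    exact ⟨t, by rw [ht]; simp⟩
  have hπx : ∀ (x : S) (t : ℝ), π ((x : EuclideanSpace ℝ (Fin n)) +
      t • (u : EuclideanSpace ℝ (Fin n))) = x := by
    intro x t
    have h1 : π (u : EuclideanSpace ℝ (Fin n)) = 0 :=
      Submodule.orthogonalProjectionOnto_orthogonalComplement_singleton_eq_zero _
    rw [map_add, map_smul, h1, smul_zero, add_zero]
    exact Submodule.orthogonalProjectionOnto_mem_subspace_eq_self x
  have hPc : IsCompact (π '' K) := hK.image π.continuous
  -- Fubini: the fibres over the shadow of K have length at most L, all others are empty.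
  have hvol : volume K ≤ volume (π '' K) * L := by
    rw [volume_eq_lintegral_orthogonal _ hu hK.measurableSet, mul_comm, ← setLIntegral_const,
      ← lintegral_indicator hPc.measurableSet]
    refine lintegral_mono fun x => ?_
    by_cases hx : x ∈ π '' K
    · rw [indicator_of_mem hx]
      exact hL x
    · rw [indicator_of_notMem hx]
      have : {t : ℝ | (x : EuclideanSpace ℝ (Fin n)) + t • (u : EuclideanSpace ℝ (Fin n)) ∈ K}
          = ∅ := by
        refine eq_empty_of_forall_notMem fun t ht => hx ⟨_, ht, hπx x t⟩
      simp [this]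
  have hvol' : volume K / L ≤ volume (π '' K) := ENNReal.div_le_of_le_mul hvol
  -- The shadow is shrunk by half towards the centre of the ball's shadow. A line over B contains
  -- the midpoints of some k ∈ K with the diameter of the ball parallel to u: a segment of length ρ
  -- inside K.
  set B : Set S := AffineMap.homothety (π z) (1 / 2 : ℝ) '' (π '' K) with hB
  have hBc : IsCompact B := hPc.image (AffineMap.homothety_continuous _ _)
  have hBv : ENNReal.ofReal ((1 / 2) ^ n) * volume (π '' K) ≤ volume B := by
    rw [hB, Measure.addHaar_image_homothety]
    gcongr
    rw [abs_of_pos (by positivity)]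
    refine pow_le_pow_of_le_one (by norm_num) (by norm_num) ?_
    simpa using S.finrank_le
  calc ENNReal.ofReal ρ ^ q * (ENNReal.ofReal ((1 / 2) ^ n) * (volume K / L))
      ≤ ENNReal.ofReal ρ ^ q * volume B := by
        gcongr
        exact (by gcongr : _ ≤ _).trans hBv
    _ = ∫⁻ x, B.indicator (fun _ => ENNReal.ofReal ρ ^ q) x := by
        rw [lintegral_indicator hBc.measurableSet, setLIntegral_const]
    _ ≤ _ := by
      refine lintegral_mono fun x => ?_
      by_cases hx : x ∈ B
      · rw [indicator_of_mem hx]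
        obtain ⟨_, ⟨k, hk, rfl⟩, rfl⟩ := hx
        obtain ⟨a, ha⟩ := hdec k
        obtain ⟨b, hb⟩ := hdec z
        have hx : ((AffineMap.homothety (π z) (1 / 2 : ℝ) (π k) : S) :
            EuclideanSpace ℝ (Fin n)) = (1 / 2 : ℝ) • k + (1 / 2 : ℝ) • z -
              ((a + b) / 2) • (u : EuclideanSpace ℝ (Fin n)) := by
          rw [AffineMap.homothety_apply]
          conv_rhs => rw [ha, hb]
          simp
          module
        have hsub : Icc ((a + b) / 2 - ρ / 2) ((a + b) / 2 + ρ / 2) ⊆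
            {t : ℝ | ((AffineMap.homothety (π z) (1 / 2 : ℝ) (π k) : S) :
              EuclideanSpace ℝ (Fin n)) + t • (u : EuclideanSpace ℝ (Fin n)) ∈ K} := by
          intro t ht
          have h1 : z + (2 * (t - (a + b) / 2)) • (u : EuclideanSpace ℝ (Fin n)) ∈ K := by
            apply hz
            rw [mem_closedBall, dist_eq_norm, add_sub_cancel_left, norm_smul, hu, mul_one,
              Real.norm_eq_abs, abs_le]
            constructor <;> linarith [ht.1, ht.2]
          have h2 := hKc hk h1 (by norm_num : (0 : ℝ) ≤ 1 / 2) (by norm_num : (0 : ℝ) ≤ 1 / 2)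
            (by norm_num)
          rw [mem_ofPred_eq, hx]
          convert h2 using 1
          module
        have hne : (K ∩ (line (u : EuclideanSpace ℝ (Fin n))
            (AffineMap.homothety (π z) (1 / 2 : ℝ) (π k) : S) :
              Set (EuclideanSpace ℝ (Fin n)))).Nonempty := by
          refine ⟨_, hsub (a := (a + b) / 2) ⟨by linarith, by linarith⟩, ?_⟩
          simp only [line, SetLike.mem_coe, AffineSubspace.mem_mk', Submodule.mem_span_singleton]
          exact ⟨(a + b) / 2, by simp⟩
        rw [if_pos hne, hausdorffMeasure_inter_line _ hu]
        refine ENNReal.rpow_le_rpow ?_ hq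
        refine le_trans (le_of_eq ?_) (measure_mono hsub)
        rw [Real.volume_Icc]
        congr 1
        ring
      · rw [indicator_of_notMem hx]
        exact zero_le

/-- Lower bound for the chord integral of a convex body by its volume, a ball contained in it and
a slab that contains it. -/
theorem exists_le_chordIntegral {n : ℕ} (hn : 2 ≤ n) {q : ℝ} (hq : 0 ≤ q) :
    ∃ κ : ℝ, 0 < κ ∧ ∀ (K : Set (EuclideanSpace ℝ (Fin n))) (z e : EuclideanSpace ℝ (Fin n))
      (ρ w : ℝ), IsCompact K → Convex ℝ K → closedBall z ρ ⊆ K → 0 < ρ → 0 < w → ‖e‖ = 1 →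
      (∀ x ∈ K, ∀ y ∈ K, inner ℝ e (x - y) ≤ w) →
      κ * ρ ^ q * (volume K).toReal / w ≤ (chordIntegral q K).toReal := by
  have : Nontrivial (EuclideanSpace ℝ (Fin n)) := by
    apply Module.nontrivial_of_finrank_pos (R := ℝ); simp; omega
  set k : ℝ≥0∞ := (sphereMeasure n univ)⁻¹ * ((n * volume (ball (0 : EuclideanSpace ℝ (Fin n))
    (1 / 8))) * ENNReal.ofReal ((1 / 2) ^ n)) with hk
  have hσ : sphereMeasure n univ ≠ ∞ := measure_ne_top _ _
  have hσ0 : sphereMeasure n univ ≠ 0 := by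
    rw [Ne, Measure.measure_univ_eq_zero]; exact Measure.toSphere_ne_zero _
  have hball0 : volume (ball (0 : EuclideanSpace ℝ (Fin n)) (1 / 8)) ≠ 0 :=
    (measure_ball_pos _ _ (by norm_num)).ne'
  have hballt : volume (ball (0 : EuclideanSpace ℝ (Fin n)) (1 / 8)) ≠ ∞ :=
    measure_ball_lt_top.ne
  have hk0 : k ≠ 0 := by
    refine mul_ne_zero (ENNReal.inv_ne_zero.2 hσ) (mul_ne_zero (mul_ne_zero ?_ hball0) ?_)
    · exact_mod_cast (by omega : n ≠ 0)
    · simp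
  have hkt : k ≠ ∞ := ENNReal.mul_ne_top (ENNReal.inv_ne_top.2 hσ0)
    (ENNReal.mul_ne_top (ENNReal.mul_ne_top (by simp) hballt) (by simp))
  refine ⟨k.toReal / 2, half_pos (ENNReal.toReal_pos hk0 hkt), ?_⟩
  intro K z e ρ w hK hKc hz hρ hw he hslab
  -- A direction at an angle of at most 60° to e crosses a slab of width w in length at most 2w.
  have hslice : ∀ u : sphere (0 : EuclideanSpace ℝ (Fin n)) 1,
      1 / 2 ≤ inner ℝ (u : EuclideanSpace ℝ (Fin n)) e → ∀ x,
      volume {t : ℝ | x + t • (u : EuclideanSpace ℝ (Fin n)) ∈ K} ≤ ENNReal.ofReal (2 * w) := by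
    intro u hu x
    refine (Real.volume_le_diam _).trans (Metric.ediam_le fun s hs t ht => ?_)
    rw [edist_dist]
    refine ENNReal.ofReal_le_ofReal ?_
    have key : ∀ s t : ℝ, x + s • (u : EuclideanSpace ℝ (Fin n)) ∈ K →
        x + t • (u : EuclideanSpace ℝ (Fin n)) ∈ K → s - t ≤ 2 * w := by
      intro s t hs ht
      have h1 := hslab _ hs _ ht
      rw [add_sub_add_left_eq_sub, ← sub_smul, inner_smul_right, real_inner_comm] at h1
      rcases le_or_gt (s - t) 0 with h | h
      · linarith
      · nlinarith
    rw [Real.dist_eq, abs_le]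
    constructor <;> linarith [key s t hs ht, key t s ht hs]
  set V : Set (sphere (0 : EuclideanSpace ℝ (Fin n)) 1) :=
    {u | 1 / 2 ≤ inner ℝ (u : EuclideanSpace ℝ (Fin n)) e} with hVdef
  have hV : MeasurableSet V :=
    (isClosed_le continuous_const (by fun_prop)).measurableSet
  -- The cone over V contains the ball of radius 1/8 about (3/4)e: there ‖x‖ < 7/8 and ⟨x, e⟩ > 5/8,
  -- and normalizing x only increases ⟨x, e⟩.
  have hVm : n * volume (ball (0 : EuclideanSpace ℝ (Fin n)) (1 / 8)) ≤ sphereMeasure n V := by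
    have h1 : volume (ball (0 : EuclideanSpace ℝ (Fin n)) (1 / 8)) =
        volume (ball ((3 / 4 : ℝ) • e) (1 / 8)) := by
      rw [Measure.addHaar_ball_center _ ((3 / 4 : ℝ) • e)]
    rw [h1]
    refine le_toSphere hV fun x hx => ?_
    rw [mem_ball, dist_eq_norm] at hx
    obtain ⟨y, rfl⟩ : ∃ y, x = (3 / 4 : ℝ) • e + y := ⟨x - (3 / 4 : ℝ) • e, by simp⟩
    rw [add_sub_cancel_left] at hx
    have h2 : ‖(3 / 4 : ℝ) • e‖ = 3 / 4 := by rw [norm_smul, he]; norm_num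
    have h3 : ‖(3 / 4 : ℝ) • e + y‖ < 1 := by
      linarith [norm_add_le ((3 / 4 : ℝ) • e) y]
    have h4 : 1 / 2 ≤ inner ℝ ((3 / 4 : ℝ) • e + y) e := by
      rw [inner_add_left, inner_smul_left, real_inner_self_eq_norm_sq, he]
      have := (abs_le.1 (abs_real_inner_le_norm y e)).1
      rw [he] at this
      simp
      linarith
    set x := (3 / 4 : ℝ) • e + y
    have hx0 : 0 < ‖x‖ := by
      rw [norm_pos_iff]
      rintro h
      rw [h, inner_zero_left] at h4
      norm_num at h4
    refine ⟨h3, ⟨‖x‖⁻¹ • x, by simp [norm_smul, hx0.ne']⟩, ?_, ‖x‖, hx0, by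
      simp [smul_smul, hx0.ne']⟩
    rw [hVdef, mem_ofPred_eq]
    simp only [inner_smul_left, RCLike.conj_to_real]
    have h5 : 1 ≤ ‖x‖⁻¹ := (one_le_inv₀ hx0).2 h3.le
    nlinarith
  have hmain : k * (ENNReal.ofReal ρ ^ q * (volume K / ENNReal.ofReal (2 * w))) ≤
      chordIntegral q K := by
    unfold chordIntegral lintegralLines
    rw [hk, mul_assoc]
    gcongr
    calc n * volume (ball (0 : EuclideanSpace ℝ (Fin n)) (1 / 8)) *
          ENNReal.ofReal ((1 / 2) ^ n) *
          (ENNReal.ofReal ρ ^ q * (volume K / ENNReal.ofReal (2 * w)))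
        ≤ sphereMeasure n V * ENNReal.ofReal ((1 / 2) ^ n) *
          (ENNReal.ofReal ρ ^ q * (volume K / ENNReal.ofReal (2 * w))) := by gcongr
      _ = ∫⁻ u, V.indicator (fun _ => ENNReal.ofReal ρ ^ q * (ENNReal.ofReal ((1 / 2) ^ n) *
            (volume K / ENNReal.ofReal (2 * w)))) u ∂(sphereMeasure n) := by
        rw [lintegral_indicator hV, setLIntegral_const]
        ring
      _ ≤ _ := by
        refine lintegral_mono fun u => ?_
        by_cases hu : u ∈ V
        · rw [indicator_of_mem hu]
          exact le_lintegral_chords hq hK hKc hz hρ u (hslice u hu)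
        · rw [indicator_of_notMem hu]
          exact zero_le
  have h := ENNReal.toReal_mono (chordIntegral_lt_top hn hq hK.isBounded).ne hmain
  rw [ENNReal.toReal_mul, ENNReal.toReal_mul (a := _ ^ q), ← ENNReal.toReal_rpow, ENNReal.toReal_div,
    ENNReal.toReal_ofReal hρ.le, ENNReal.toReal_ofReal (by positivity)] at h
  refine le_trans (le_of_eq ?_) h
  field_simp

/-! ### Frames of maximal determinant -/

theorem volume_euclidean_pi_Icc {n : ℕ} (a b : Fin n → ℝ) :
    volume {x : EuclideanSpace ℝ (Fin n) | ∀ i, x i ∈ Icc (a i) (b i)} =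
      ∏ i, ENNReal.ofReal (b i - a i) := by
  have h := PiLp.volume_preserving_toLp (Fin n)
  have h1 : (WithLp.toLp 2) ⁻¹' {x : EuclideanSpace ℝ (Fin n) | ∀ i, x i ∈ Icc (a i) (b i)} =
      Icc a b := by
    ext x; simp [Pi.le_def, forall_and]
  have hc : IsClosed {x : EuclideanSpace ℝ (Fin n) | ∀ i, x i ∈ Icc (a i) (b i)} := by
    rw [ofPred_forall]
    exact isClosed_iInter fun i => isClosed_Icc.preimage (by fun_prop)
  rw [← h.measure_preimage hc.measurableSet.nullMeasurableSet, h1, Real.volume_Icc_pi]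

theorem volume_euclidean_box (n : ℕ) (a b : ℝ) :
    volume {x : EuclideanSpace ℝ (Fin n) | ∀ i, x i ∈ Icc a b} = ENNReal.ofReal (b - a) ^ n := by
  simpa using volume_euclidean_pi_Icc (fun _ : Fin n => a) fun _ => b

section Frame

variable {n : ℕ} (w : Fin n → EuclideanSpace ℝ (Fin n))

/-- The matrix whose rows are the given vectors. -/
def rowMatrix : Matrix (Fin n) (Fin n) ℝ := Matrix.of fun i j => w i j

theorem det_toEuclideanLin (M : Matrix (Fin n) (Fin n) ℝ) :
    LinearMap.det (Matrix.toEuclideanLin M) = M.det := by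
  rw [Matrix.toEuclideanLin_eq_toLin_orthonormal, LinearMap.det_toLin]

theorem toEuclideanLin_rowMatrix_apply (v : EuclideanSpace ℝ (Fin n)) (i : Fin n) :
    Matrix.toEuclideanLin (rowMatrix w) v i = inner ℝ (w i) v := by
  simp [Matrix.toLpLin_apply, Matrix.mulVec, dotProduct, rowMatrix, PiLp.inner_apply,
    mul_comm]

theorem toEuclideanLin_rowMatrix_transpose_apply (t : EuclideanSpace ℝ (Fin n)) :
    Matrix.toEuclideanLin (rowMatrix w).transpose t = ∑ i, t i • w i := by
  ext j
  simp [Matrix.toLpLin_apply, Matrix.mulVec, dotProduct, rowMatrix, mul_comm]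

theorem volume_parallelepiped_frame (a b : ℝ) :
    volume {x | ∃ t : EuclideanSpace ℝ (Fin n), (∀ i, t i ∈ Icc a b) ∧ ∑ i, t i • w i = x} =
      ENNReal.ofReal |(rowMatrix w).det| * ENNReal.ofReal (b - a) ^ n := by
  have h : {x | ∃ t : EuclideanSpace ℝ (Fin n), (∀ i, t i ∈ Icc a b) ∧ ∑ i, t i • w i = x} =
      Matrix.toEuclideanLin (rowMatrix w).transpose ''
        {x : EuclideanSpace ℝ (Fin n) | ∀ i, x i ∈ Icc a b} := by
    simp_rw [image, toEuclideanLin_rowMatrix_transpose_apply]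
    rfl
  rw [h, Measure.addHaar_image_linearMap, volume_euclidean_box, det_toEuclideanLin,
    Matrix.det_transpose]

theorem volume_polar_frame (hw : (rowMatrix w).det ≠ 0) (ρ : ℝ) :
    volume {v | ∀ i, |inner ℝ (w i) v| ≤ ρ} =
      ENNReal.ofReal |(rowMatrix w).det|⁻¹ * ENNReal.ofReal (2 * ρ) ^ n := by
  have h : {v | ∀ i, |inner ℝ (w i) v| ≤ ρ} = Matrix.toEuclideanLin (rowMatrix w) ⁻¹'
        {x : EuclideanSpace ℝ (Fin n) | ∀ i, x i ∈ Icc (-ρ) ρ} := by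
    ext v
    simp [toEuclideanLin_rowMatrix_apply, abs_le]
  rw [h, Measure.addHaar_preimage_linearMap, volume_euclidean_box, det_toEuclideanLin]
  · rw [abs_inv]
    congr 3
    ring
  · rwa [det_toEuclideanLin]

end Frame

/-- A body containing the origin contains the frame of a simplex of maximal volume, and lies in
the parallelepiped spanned by this frame. -/
theorem exists_maximal_frame {n : ℕ} {K : Set (EuclideanSpace ℝ (Fin n))} (hK : IsCompact K)
    (h0 : 0 ∈ interior K) :
    ∃ w : Fin n → EuclideanSpace ℝ (Fin n), (rowMatrix w).det ≠ 0 ∧ (∀ i, w i ∈ K) ∧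
      ∀ x ∈ K, ∃ t : EuclideanSpace ℝ (Fin n), (∀ i, |t i| ≤ 1) ∧ ∑ i, t i • w i = x := by
  have hcont : Continuous fun w : Fin n → EuclideanSpace ℝ (Fin n) => |(rowMatrix w).det| := by
    refine (Continuous.matrix_det ?_).abs
    refine continuous_matrix fun i j => ?_
    simp only [rowMatrix, Matrix.of_apply]
    fun_prop
  obtain ⟨w, hwK, hmax⟩ := (isCompact_univ_pi fun _ : Fin n => hK).exists_isMaxOn
    ⟨0, fun _ _ => interior_subset h0⟩ hcont.continuousOn
  have hdet : (rowMatrix w).det ≠ 0 := by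
    obtain ⟨ε, hε, hb⟩ := Metric.isOpen_iff.1 isOpen_interior 0 h0
    -- A small multiple of the standard basis competes in the maximum, which is therefore nonzero.
    have h1 : (fun i => (ε / 2) • EuclideanSpace.single i (1 : ℝ)) ∈
        Set.pi univ fun _ : Fin n => K := by
      intro i _
      refine interior_subset (hb ?_)
      simp [norm_smul, abs_of_pos hε]
      linarith
    have h2 := hmax h1
    have h3 : rowMatrix (fun i : Fin n => (ε / 2) • EuclideanSpace.single i (1 : ℝ)) =
        (ε / 2) • (1 : Matrix (Fin n) (Fin n) ℝ) := by
      ext i j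
      simp [rowMatrix, Matrix.one_apply, eq_comm]
    simp only [mem_ofPred_eq, h3, Matrix.det_smul, Matrix.det_one, mul_one] at h2
    have h4 : 0 < |(ε / 2) ^ Fintype.card (Fin n)| := by positivity
    exact abs_pos.1 (h4.trans_le h2)
  refine ⟨w, hdet, fun i => hwK i (mem_univ i), fun x hx => ?_⟩
  set t : EuclideanSpace ℝ (Fin n) :=
    Matrix.toEuclideanLin ((rowMatrix w).transpose)⁻¹ x with ht
  have hu : IsUnit (rowMatrix w).transpose.det := by
    rw [Matrix.det_transpose]; exact hdet.isUnit
  have htx : ∑ i, t i • w i = x := by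
    rw [← toEuclideanLin_rowMatrix_transpose_apply, ht]
    simp only [Matrix.toLpLin_apply, Matrix.mulVec_mulVec, Matrix.mul_nonsing_inv _ hu,
      Matrix.one_mulVec]
  refine ⟨t, fun i => ?_, htx⟩
  -- Cramer's rule: replacing wᵢ by x = Σ tₖwₖ multiplies the determinant by tᵢ, so maximality gives
  -- |tᵢ| ≤ 1.
  have hupd : rowMatrix (Function.update w i x) = (rowMatrix w).updateRow i (fun j => x j) := by
    ext a j
    by_cases ha : a = i
    · subst ha; simp [rowMatrix]
    · simp [rowMatrix, ha]
  have hx' : (fun j => x j) = ∑ k, t k • (rowMatrix w) k := by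
    ext j
    rw [← htx]
    simp [rowMatrix]
  have hmem : Function.update w i x ∈ Set.pi univ fun _ : Fin n => K := by
    intro k _
    by_cases hk : k = i
    · subst hk; simpa using hx
    · simpa [hk] using hwK k (mem_univ k)
  have h5 := hmax hmem
  simp only [mem_ofPred_eq, hupd, hx', Matrix.det_updateRow_sum] at h5
  rw [smul_eq_mul, abs_mul] at h5
  exact le_of_mul_le_mul_right (by simpa using h5) (abs_pos.2 hdet)

/-- The seminorm `v ↦ ∑ |⟨wᵢ, v⟩|` attached to a frame attains its minimum on the sphere. -/
theorem exists_min_frame {n : ℕ} (hn : 2 ≤ n) {w : Fin n → EuclideanSpace ℝ (Fin n)}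
    (hw : (rowMatrix w).det ≠ 0) :
    ∃ e : EuclideanSpace ℝ (Fin n), ‖e‖ = 1 ∧ 0 < ∑ i, |inner ℝ (w i) e| ∧
      ∀ v, (∑ i, |inner ℝ (w i) e|) * ‖v‖ ≤ ∑ i, |inner ℝ (w i) v| := by
  have : Nontrivial (EuclideanSpace ℝ (Fin n)) := by
    apply Module.nontrivial_of_finrank_pos (R := ℝ); simp; omega
  have hc : Continuous fun v : EuclideanSpace ℝ (Fin n) => ∑ i, |inner ℝ (w i) v| := by fun_prop
  obtain ⟨e, he, hmin⟩ := (isCompact_sphere (0 : EuclideanSpace ℝ (Fin n)) 1).exists_isMinOn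
    (NormedSpace.sphere_nonempty.2 zero_le_one) hc.continuousOn
  have he1 : ‖e‖ = 1 := by simpa using he
  refine ⟨e, he1, ?_, fun v => ?_⟩
  · refine (Finset.sum_nonneg fun i _ => abs_nonneg _).lt_of_ne fun h0 => ?_
    have h1 := (Finset.sum_eq_zero_iff_of_nonneg fun i _ => abs_nonneg _).1 h0.symm
    have h2 : (rowMatrix w).mulVec e = 0 := by
      ext i
      have h3 : inner ℝ (w i) e = 0 := by simpa using h1 i (Finset.mem_univ i)
      rw [← toEuclideanLin_rowMatrix_apply] at h3
      exact h3
    have h4 := Matrix.eq_zero_of_mulVec_eq_zero hw h2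
    have h5 : e = 0 := by ext i; exact congrFun h4 i
    simp [h5] at he1
  · rcases eq_or_ne v 0 with rfl | hv
    · simp
    · have hv0 : 0 < ‖v‖ := norm_pos_iff.2 hv
      have h1 := hmin (a := ‖v‖⁻¹ • v) (by simp [norm_smul, hv0.ne'])
      simp only [mem_ofPred_eq, inner_smul_right, abs_mul, ← Finset.mul_sum, abs_inv,
        abs_norm] at h1
      rw [le_inv_mul_iff₀ hv0] at h1
      linarith

section FrameBounds

variable {n : ℕ} {w : Fin n → EuclideanSpace ℝ (Fin n)} {r : ℝ}

/-- The parallelepiped of a frame has inradius bounded below by the minimum of the dual norm. -/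
theorem exists_coeff_of_norm_le (hw : (rowMatrix w).det ≠ 0) (hr : 0 < r)
    (h : ∀ v, r * ‖v‖ ≤ ∑ i, |inner ℝ (w i) v|) (y : EuclideanSpace ℝ (Fin n)) :
    ∃ t : EuclideanSpace ℝ (Fin n), (∀ i, |t i| ≤ ‖y‖ / r) ∧ ∑ i, t i • w i = y := by
  have hu : IsUnit (rowMatrix w).det := hw.isUnit
  have hu' : IsUnit (rowMatrix w).transpose.det := by rwa [Matrix.det_transpose]
  set t : EuclideanSpace ℝ (Fin n) :=
    Matrix.toEuclideanLin ((rowMatrix w).transpose)⁻¹ y with ht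
  have hty : ∑ i, t i • w i = y := by
    rw [← toEuclideanLin_rowMatrix_transpose_apply, ht]
    simp only [Matrix.toLpLin_apply, Matrix.mulVec_mulVec, Matrix.mul_nonsing_inv _ hu',
      Matrix.one_mulVec]
  refine ⟨t, fun i => ?_, hty⟩
  -- The i-th vector of the dual basis. It reads off tᵢ as an inner product, and since Σ |⟨wⱼ, d⟩| =
  -- 1 its norm is at most 1/r.
  set d : EuclideanSpace ℝ (Fin n) :=
    Matrix.toEuclideanLin (rowMatrix w)⁻¹ (EuclideanSpace.single i 1) with hd
  have hwd : ∀ j, inner ℝ (w j) d = if j = i then 1 else 0 := by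
    intro j
    rw [← toEuclideanLin_rowMatrix_apply, hd]
    simp only [Matrix.toLpLin_apply, Matrix.mulVec_mulVec, Matrix.mul_nonsing_inv _ hu,
      Matrix.one_mulVec]
    simp
  have hdn : ‖d‖ ≤ 1 / r := by
    rw [le_div_iff₀ hr, mul_comm]
    refine (h d).trans (le_of_eq ?_)
    simp [hwd, apply_ite abs]
  have hti : t i = inner ℝ y d := by
    rw [← hty, sum_inner]
    simp [inner_smul_left, hwd]
  rw [hti]
  calc |inner ℝ y d| ≤ ‖y‖ * ‖d‖ := abs_real_inner_le_norm _ _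
    _ ≤ ‖y‖ * (1 / r) := by gcongr
    _ = ‖y‖ / r := by ring

/-- The set where all |⟨wᵢ, v⟩| ≤ r/n lies in the unit ball, by the choice of r, and in the slab of
half-width r/(n‖wⱼ‖) orthogonal to wⱼ. It thus lies in a cylinder with axis wⱼ, and the two volumes
are compared. -/
theorem norm_mul_pow_le (hn : 2 ≤ n) (hw : (rowMatrix w).det ≠ 0) (hr : 0 < r)
    (h : ∀ v, r * ‖v‖ ≤ ∑ i, |inner ℝ (w i) v|) (j : Fin n) :
    ‖w j‖ * (2 * r / n) ^ n ≤ hyperplaneBallVolume n * (2 * r / n) * |(rowMatrix w).det| := by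
  have hn0 : (0 : ℝ) < n := by exact_mod_cast (by omega : 0 < n)
  have hD : 0 < |(rowMatrix w).det| := abs_pos.2 hw
  rcases eq_or_ne (w j) 0 with hj | hj
  · rw [hj, norm_zero, zero_mul]
    have := hyperplaneBallVolume_pos n
    positivity
  have hj0 : 0 < ‖w j‖ := norm_pos_iff.2 hj
  set u : EuclideanSpace ℝ (Fin n) := ‖w j‖⁻¹ • w j with hu
  have hu1 : ‖u‖ = 1 := by simp [hu, norm_smul, hj0.ne']
  have hsub : {v | ∀ i, |inner ℝ (w i) v| ≤ r / n} ⊆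
      (fun z : ((Submodule.span ℝ {u})ᗮ : Submodule ℝ (EuclideanSpace ℝ (Fin n))) × ℝ =>
      (z.1 : EuclideanSpace ℝ (Fin n)) + z.2 • u) ''
        (closedBall 0 1 ×ˢ Icc (-(r / n / ‖w j‖)) (r / n / ‖w j‖)) := by
    intro v hv
    have hv1 : ‖v‖ ≤ 1 := by
      have h1 : ∑ i, |inner ℝ (w i) v| ≤ ∑ _i : Fin n, r / n :=
        Finset.sum_le_sum fun i _ => hv i
      rw [Finset.sum_const, Finset.card_univ, Fintype.card_fin, nsmul_eq_mul,
        mul_div_cancel₀ _ hn0.ne'] at h1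
      have h2 := (h v).trans h1
      nlinarith
    refine ⟨((Submodule.span ℝ {u})ᗮ.orthogonalProjectionOnto v, inner ℝ u v), ⟨?_, ?_⟩, ?_⟩
    · rw [mem_closedBall_zero_iff]
      exact (Submodule.norm_orthogonalProjectionOnto_apply_le _ v).trans hv1
    · rw [mem_Icc, ← abs_le, hu, inner_smul_left, RCLike.conj_to_real, abs_mul, abs_inv, abs_norm,
        le_div_iff₀ hj0, mul_right_comm, inv_mul_cancel₀ hj0.ne', one_mul]
      exact hv j
    · have h1 := (Submodule.span ℝ {u}).starProjection_add_starProjection_orthogonal v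
      rw [Submodule.starProjection_unit_singleton ℝ hu1, add_comm] at h1
      exact h1
  have hvol := measure_mono (μ := volume) hsub
  rw [volume_polar_frame w hw, volume_cylinder hn u hu1, ← ENNReal.ofReal_pow (by positivity),
    ← ENNReal.ofReal_mul (by positivity), ENNReal.ofReal_one, one_pow, one_mul,
    ← ENNReal.ofReal_mul (hyperplaneBallVolume_pos n).le,
    ENNReal.ofReal_le_ofReal_iff (by
      rw [sub_neg_eq_add]
      have := hyperplaneBallVolume_pos n
      positivity), inv_mul_le_iff₀ hD] at hvol
  calc ‖w j‖ * (2 * r / n) ^ n = ‖w j‖ * (2 * (r / n)) ^ n := by rw [mul_div_assoc]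
    _ ≤ ‖w j‖ * (|(rowMatrix w).det| *
        (hyperplaneBallVolume n * (r / n / ‖w j‖ - -(r / n / ‖w j‖)))) := by gcongr
    _ = _ := by field_simp; ring

end FrameBounds

/-! ### Confinement between two balls -/

/-- A convex body is squeezed between a simplex and a parallelepiped. The number `r` plays the
role of the smallest semi-axis, `D` that of the volume. -/
theorem exists_frame_bounds {n : ℕ} (hn : 2 ≤ n) {K : Set (EuclideanSpace ℝ (Fin n))}
    (hK : IsCompact K) (hKc : Convex ℝ K) (h0 : 0 ∈ interior K) :
    ∃ (z e : EuclideanSpace ℝ (Fin n)) (r D l : ℝ) (W : Set (EuclideanSpace ℝ (Fin n))),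
      0 < r ∧ 0 < D ∧ ‖e‖ = 1 ∧ closedBall z (r / (2 * n)) ⊆ K ∧
      (∀ x ∈ K, ∀ y ∈ K, inner ℝ e (x - y) ≤ 2 * r) ∧
      (1 / n : ℝ) ^ n * D ≤ (volume K).toReal ∧
      (∀ x ∈ W, 1 / 2 ≤ ‖x‖ ∧ ‖x‖ < 1 ∧ ∀ y ∈ K, inner ℝ x y ≤ r) ∧
      (volume W).toReal = D⁻¹ * (r / (4 * n)) ^ n ∧
      (∀ x ∈ K, ‖x‖ ≤ n * l) ∧
      l * (2 * r / n) ^ n ≤ hyperplaneBallVolume n * (2 * r / n) * D := by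
  have hn0 : (0 : ℝ) < n := by exact_mod_cast (by omega : 0 < n)
  have : Nonempty (Fin n) := ⟨⟨0, by omega⟩⟩
  obtain ⟨w, hw, hwK, hKw⟩ := exists_maximal_frame hK h0
  obtain ⟨e, he, hr, hmin⟩ := exists_min_frame hn hw
  set r := ∑ i, |inner ℝ (w i) e| with hrdef
  obtain ⟨j, hj⟩ := Finite.exists_max fun i => ‖w i‖
  have hD : 0 < |(rowMatrix w).det| := abs_pos.2 hw
  have hinner : ∀ v, ∀ y ∈ K, |inner ℝ v y| ≤ ∑ i, |inner ℝ (w i) v| := by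
    intro v y hy
    obtain ⟨t, ht, rfl⟩ := hKw y hy
    rw [inner_sum]
    refine (Finset.abs_sum_le_sum_abs _ _).trans (Finset.sum_le_sum fun i _ => ?_)
    rw [inner_smul_right, abs_mul, real_inner_comm]
    exact mul_le_of_le_one_left (abs_nonneg _) (ht i)
  have hsimplex : ∀ t : EuclideanSpace ℝ (Fin n), (∀ i, t i ∈ Icc 0 (1 / (n : ℝ))) →
      ∑ i, t i • w i ∈ K := by
    intro t ht
    have hsum : ∑ i, t i ≤ 1 := by
      calc ∑ i, t i ≤ ∑ _i : Fin n, 1 / (n : ℝ) := Finset.sum_le_sum fun i _ => (ht i).2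
        _ = 1 := by simp [hn0.ne']
    -- The index `none` stands for the vertex 0, which carries the remaining weight 1 - Σ tᵢ.
    have h1 := hKc.sum_mem (t := Finset.univ) (w := fun o : Option (Fin n) =>
      o.elim (1 - ∑ i, t i) t) (z := fun o => o.elim 0 w) ?_ ?_ ?_
    · simpa [Fintype.sum_option] using h1
    · rintro (_ | i) _
      · simpa using hsum
      · exact (ht i).1
    · simp [Fintype.sum_option]
    · rintro (_ | i) _
      · exact interior_subset h0
      · exact hwK i
  -- The point z is the centre of the parallelepiped of coefficients in [0, 1/n], which lies in the
  -- simplex. For W, the size r/(8n) makes Σ |⟨wᵢ, v⟩| ≤ r/8; hence ‖v‖ ≤ 1/8, and for x = (3/4)e +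
  -- v and y ∈ K, ⟨x, y⟩ ≤ 3r/4 + r/8.
  refine ⟨∑ i, (1 / (2 * n) : ℝ) • w i, e, r, |(rowMatrix w).det|, ‖w j‖,
    (fun y => (3 / 4 : ℝ) • e + y) '' {v | ∀ i, |inner ℝ (w i) v| ≤ r / (8 * n)},
    hr, hD, he, ?_, ?_, ?_, ?_, ?_, ?_, norm_mul_pow_le hn hw hr hmin j⟩
  · intro y hy
    rw [mem_closedBall, dist_eq_norm] at hy
    obtain ⟨t, ht, hty⟩ := exists_coeff_of_norm_le hw hr hmin
      (y - ∑ i, (1 / (2 * n) : ℝ) • w i)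
    have hb : ∀ i, |t i| ≤ 1 / (2 * n) := fun i => (ht i).trans (by
      rw [div_le_iff₀ hr]
      exact hy.trans (le_of_eq (by ring)))
    have h1 := hsimplex (WithLp.toLp 2 fun i => t i + 1 / (2 * n)) (fun i => by
      have h2 := abs_le.1 (hb i)
      have h3 : (1 / n : ℝ) = 1 / (2 * n) + 1 / (2 * n) := by field_simp; norm_num
      refine ⟨?_, ?_⟩
      · simp only; linarith [h2.1]
      · simp only; rw [h3]; linarith [h2.2])
    simp only [add_smul, Finset.sum_add_distrib, hty, sub_add_cancel] at h1
    exact h1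
  · intro x hx y hy
    rw [inner_sub_right]
    have h1 := (abs_le.1 (hinner e x hx)).2
    have h2 := (abs_le.1 (hinner e y hy)).1
    linarith
  · have h1 := volume_parallelepiped_frame w 0 (1 / n)
    have h2 : volume {x | ∃ t : EuclideanSpace ℝ (Fin n), (∀ i, t i ∈ Icc 0 (1 / (n : ℝ))) ∧
        ∑ i, t i • w i = x} ≤ volume K := by
      refine measure_mono ?_
      rintro _ ⟨t, ht, rfl⟩
      exact hsimplex t ht
    have h3 := ENNReal.toReal_mono hK.measure_ne_top h2
    rw [h1, sub_zero, ENNReal.toReal_mul, ENNReal.toReal_pow, ENNReal.toReal_ofReal hD.le,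
      ENNReal.toReal_ofReal (by positivity)] at h3
    linarith
  · rintro _ ⟨v, hv, rfl⟩
    have hsum : ∑ i, |inner ℝ (w i) v| ≤ r / 8 := by
      calc ∑ i, |inner ℝ (w i) v| ≤ ∑ _i : Fin n, r / (8 * n) :=
            Finset.sum_le_sum fun i _ => hv i
        _ = r / 8 := by simp; field_simp
    have hv1 : ‖v‖ ≤ 1 / 8 := by
      have := (hmin v).trans hsum
      nlinarith
    have h2 : ‖(3 / 4 : ℝ) • e‖ = 3 / 4 := by rw [norm_smul, he]; norm_num
    have h3 := norm_add_le ((3 / 4 : ℝ) • e) v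
    have h4 := norm_sub_le_norm_add ((3 / 4 : ℝ) • e) v
    refine ⟨by linarith, by linarith, fun y hy => ?_⟩
    rw [inner_add_left, inner_smul_left, RCLike.conj_to_real]
    have h5 := (abs_le.1 (hinner e y hy)).2
    have h6 := (abs_le.1 (hinner v y hy)).2
    linarith
  · rw [image_add_left, measure_preimage_add, volume_polar_frame w hw, ENNReal.toReal_mul,
      ENNReal.toReal_pow, ENNReal.toReal_ofReal (by positivity),
      ENNReal.toReal_ofReal (by positivity)]
    congr 2
    field_simp
    norm_num
  · intro x hx
    obtain ⟨t, ht, rfl⟩ := hKw x hx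
    calc ‖∑ i, t i • w i‖ ≤ ∑ _i : Fin n, ‖w j‖ := by
          refine norm_sum_le_of_le _ fun i _ => ?_
          rw [norm_smul, Real.norm_eq_abs]
          exact (mul_le_of_le_one_left (norm_nonneg _) (ht i)).trans (hj i)
      _ = n * ‖w j‖ := by simp

/-- Eliminating D leaves r^(p+n+q-1) ≤ k₁k₂ and l ≤ k₁k₃ r^(2-n-q), where the first exponent is
negative and the second is nonpositive. -/
theorem exists_bounds_of_rpow_le {n : ℕ} (hn : 2 ≤ n) {p q : ℝ} (hq : 0 ≤ q)
    (hp : p < -(n : ℝ) - q + 1) {k₁ k₂ k₃ : ℝ} (hk₁ : 0 < k₁) (hk₂ : 0 < k₂) (hk₃ : 0 < k₃) :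
    ∃ r₀ L : ℝ, 0 < r₀ ∧ 0 < L ∧ ∀ r D l : ℝ, 0 < r → D ≤ k₁ * r ^ (1 - q) →
      r ^ (p + n) ≤ k₂ * D → l * r ^ ((n : ℝ) - 1) ≤ k₃ * D → r₀ ≤ r ∧ l ≤ L := by
  have hm : p + n + q - 1 < 0 := by linarith
  have hn' : (2 : ℝ) ≤ n := by exact_mod_cast hn
  set r₀ : ℝ := (k₁ * k₂) ^ (p + n + q - 1)⁻¹ with hr₀
  have hr₀p : 0 < r₀ := by positivity
  refine ⟨r₀, k₁ * k₃ * r₀ ^ (2 - n - q), hr₀p, by positivity, fun r D l hr h1 h2 h3 => ?_⟩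
  have hrr : r₀ ≤ r := by
    have h4 : r ^ (p + n + q - 1) ≤ k₁ * k₂ := by
      have h5 : r ^ (p + n) ≤ k₂ * (k₁ * r ^ (1 - q)) := h2.trans (by gcongr)
      have h6 : p + n + q - 1 = (p + n) - (1 - q) := by ring
      rw [h6, Real.rpow_sub hr, div_le_iff₀ (by positivity)]
      linarith
    rw [hr₀]
    calc (k₁ * k₂) ^ (p + n + q - 1)⁻¹ ≤ (r ^ (p + n + q - 1)) ^ (p + n + q - 1)⁻¹ :=
          Real.rpow_le_rpow_of_nonpos (by positivity) h4 (inv_nonpos.2 hm.le)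
      _ = r := Real.rpow_rpow_inv hr.le hm.ne
  refine ⟨hrr, ?_⟩
  have h5 : l * r ^ ((n : ℝ) - 1) ≤ k₃ * (k₁ * r ^ (1 - q)) := h3.trans (by gcongr)
  calc l ≤ k₃ * (k₁ * r ^ (1 - q)) / r ^ ((n : ℝ) - 1) := by
        rwa [le_div_iff₀ (by positivity)]
    _ = k₁ * k₃ * r ^ (2 - n - q) := by
        have h6 : 2 - (n : ℝ) - q = (1 - q) - (n - 1) := by ring
        rw [h6, Real.rpow_sub hr (1 - q)]
        ring
    _ ≤ _ := by
        have := Real.rpow_le_rpow_of_nonpos hr₀p hrr (by linarith : 2 - (n : ℝ) - q ≤ 0)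
        gcongr

/-- Bounds for the two terms of the functional confine a convex body between two balls. -/
theorem exists_radii {n : ℕ} (hn : 2 ≤ n) {p q c₀ B : ℝ} (hq : 0 ≤ q)
    (hp : p < -(n : ℝ) - q + 1) (hc₀ : 0 < c₀) (hB : 0 < B) :
    ∃ ρ R : ℝ, 0 < ρ ∧ 0 < R ∧
      ∀ f : sphere (0 : EuclideanSpace ℝ (Fin n)) 1 → ℝ, AEMeasurable f (sphereMeasure n) →
      (∀ᵐ u ∂(sphereMeasure n), 1 / c₀ ≤ f u ∧ f u ≤ c₀) →
      ∀ K : Set (EuclideanSpace ℝ (Fin n)), IsCompact K → Convex ℝ K → 0 ∈ interior K →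
      (chordIntegral q K).toReal ≤ B →
      ∫ u, f u * supportFunction K (u : EuclideanSpace ℝ (Fin n)) ^ p ∂(sphereMeasure n) ≤ B →
      (∃ z, closedBall z ρ ⊆ K) ∧ ∀ x ∈ K, ‖x‖ ≤ R := by
  have hn0 : (0 : ℝ) < n := by exact_mod_cast (by omega : 0 < n)
  have hn2 : (2 : ℝ) ≤ n := by exact_mod_cast hn
  have hω := hyperplaneBallVolume_pos n
  obtain ⟨κ, hκ, hchord⟩ := exists_le_chordIntegral hn hq
  -- k₁ collects the ball radius r/(2n), the slab width 2r and the volume bound D/nⁿ; k₂ collects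
  -- the bound 2r for h and the volume of W; k₃ comes from the bound on l.
  obtain ⟨r₀, L, hr₀, hL, hbounds⟩ := exists_bounds_of_rpow_le hn hq hp
    (k₁ := B * 2 * n ^ n * (2 * n) ^ q / κ)
    (k₂ := B * c₀ * (4 * n) ^ n / (2 ^ p * n))
    (k₃ := hyperplaneBallVolume n * (2 / n) / (2 / n) ^ n) (by positivity) (by positivity)
    (by positivity)
  refine ⟨r₀ / (2 * n), n * L, by positivity, by positivity, ?_⟩
  intro f hf hfb K hK hKc h0 hI hJ
  obtain ⟨z, e, r, D, l, W, hr, hD, he, hz, hslab, hvol, hW, hWvol, hKl, hl⟩ :=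
    exists_frame_bounds hn hK hKc h0
  have h1 := (hchord K z e (r / (2 * n)) (2 * r) hK hKc hz (by positivity) (by positivity) he
    hslab).trans hI
  have h2 := (le_integral_supportFunction hKl h0 (by linarith) hc₀ hr hf hfb hW).trans hJ
  have h1' : D ≤ B * 2 * n ^ n * (2 * n) ^ q / κ * r ^ (1 - q) := by
    have h3 : κ * (r / (2 * n)) ^ q * ((1 / n : ℝ) ^ n * D) / (2 * r) ≤ B :=
      le_trans (by gcongr) h1
    rw [Real.div_rpow hr.le (by positivity), div_le_iff₀ (by positivity)] at h3
    rw [Real.rpow_sub hr, Real.rpow_one]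
    have h4 : D = κ * (r ^ q / (2 * n) ^ q) * ((1 / n : ℝ) ^ n * D) *
        (n ^ n * (2 * n) ^ q / (κ * r ^ q)) := by
      rw [div_pow, one_pow]; field_simp
    rw [h4]
    calc _ ≤ B * (2 * r) * (n ^ n * (2 * n) ^ q / (κ * r ^ q)) := by gcongr
      _ = _ := by field_simp
  have h2' : r ^ (p + n) ≤ B * c₀ * (4 * n) ^ n / (2 ^ p * n) * D := by
    rw [hWvol, Real.mul_rpow two_pos.le hr.le, div_pow] at h2
    rw [Real.rpow_add hr, Real.rpow_natCast]
    have h4 : r ^ p * r ^ n = 1 / c₀ * (2 ^ p * r ^ p) * (n * (D⁻¹ * (r ^ n / (4 * n) ^ n))) *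
        (c₀ * (4 * n) ^ n / (2 ^ p * n) * D) := by
      field_simp
    rw [h4]
    calc _ ≤ B * (c₀ * (4 * n) ^ n / (2 ^ p * n) * D) := by gcongr
      _ = _ := by ring
  have h3' : l * r ^ ((n : ℝ) - 1) ≤ hyperplaneBallVolume n * (2 / n) / (2 / n) ^ n * D := by
    rw [Real.rpow_sub hr, Real.rpow_natCast, Real.rpow_one]
    rw [mul_div_right_comm, mul_pow] at hl
    have h4 : l * (r ^ n / r) = l * ((2 / n) ^ n * r ^ n) / ((2 / n) ^ n * r) := by field_simp
    rw [h4, div_le_iff₀ (by positivity)]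
    refine hl.trans (le_of_eq ?_)
    field_simp
  obtain ⟨hr0, hlL⟩ := hbounds r D l hr h1' h2' h3'
  exact ⟨⟨z, (closedBall_subset_closedBall (by gcongr)).trans hz⟩,
    fun x hx => (hKl x hx).trans (by gcongr)⟩

/-! ### The origin near the boundary -/

/-- If the origin is close to the boundary of a convex body, then the support function is small in
some direction. -/
theorem exists_inner_le_of_infDist_frontier_lt {n : ℕ} {K : Set (EuclideanSpace ℝ (Fin n))}
    (hKc : Convex ℝ K) (h0 : 0 ∈ interior K) {δ : ℝ} (hδ : infDist 0 (frontier K) ∈ Ioo 0 δ) :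
    ∃ e : EuclideanSpace ℝ (Fin n), ‖e‖ = 1 ∧ ∀ y ∈ K, inner ℝ e y ≤ δ := by
  have hne : (frontier K).Nonempty := by
    by_contra h
    rw [not_nonempty_iff_eq_empty] at h
    -- The distance to the empty set is 0 by convention, which the open interval excludes.
    simp [h] at hδ
  obtain ⟨x, hx, hxδ⟩ := (infDist_lt_iff hne).1 hδ.2
  -- A supporting hyperplane at a boundary point x with ‖x‖ < δ; its unit normal e satisfies ⟨e, y⟩
  -- ≤ ⟨e, x⟩ ≤ ‖x‖ on K.
  obtain ⟨φ, hφ⟩ := geometric_hahn_banach_open_point hKc.interior isOpen_interior hx.2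
  have hφK : ∀ y ∈ K, φ y ≤ φ x := by
    intro y hy
    have hcl : closure (interior K) ⊆ {y | φ y ≤ φ x} :=
      closure_minimal (fun y hy => (hφ y hy).le) (isClosed_le φ.continuous continuous_const)
    rw [hKc.closure_interior_eq_closure_of_nonempty_interior ⟨0, h0⟩] at hcl
    exact hcl (subset_closure hy)
  set e := (InnerProductSpace.toDual ℝ (EuclideanSpace ℝ (Fin n))).symm φ with he
  have heφ : ∀ y, inner ℝ e y = φ y := fun y => InnerProductSpace.toDual_symm_apply
  have he0 : 0 < ‖e‖ := by
    rw [norm_pos_iff]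
    rintro h
    have h1 := hφ 0 h0
    rw [← heφ, ← heφ, h, inner_zero_left, inner_zero_left] at h1
    exact lt_irrefl _ h1
  refine ⟨‖e‖⁻¹ • e, by simp [norm_smul, he0.ne'], fun y hy => ?_⟩
  rw [inner_smul_left, RCLike.conj_to_real, inv_mul_le_iff₀ he0, heφ]
  refine (hφK y hy).trans ?_
  rw [← heφ]
  refine (real_inner_le_norm _ _).trans ?_
  rw [dist_zero_left] at hxδ
  gcongr

/-- The integral term of the functional is large when the origin is close to the boundary of a
body of bounded diameter. -/
theorem exists_lt_integral_of_infDist {n : ℕ} (hn : 2 ≤ n) {p c₀ R B : ℝ}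
    (hp : p < 1 - (n : ℝ)) (hc₀ : 0 < c₀) (hR : 0 < R) (hB : 0 < B) :
    ∃ δ : ℝ, 0 < δ ∧
      ∀ f : sphere (0 : EuclideanSpace ℝ (Fin n)) 1 → ℝ, AEMeasurable f (sphereMeasure n) →
      (∀ᵐ u ∂(sphereMeasure n), 1 / c₀ ≤ f u ∧ f u ≤ c₀) →
      ∀ K : Set (EuclideanSpace ℝ (Fin n)), Convex ℝ K → 0 ∈ interior K → (∀ x ∈ K, ‖x‖ ≤ R) →
      infDist 0 (frontier K) ∈ Ioo 0 δ →
      B < ∫ u, f u * supportFunction K (u : EuclideanSpace ℝ (Fin n)) ^ p ∂(sphereMeasure n) := by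
  have hn2 : (2 : ℝ) ≤ n := by exact_mod_cast hn
  have hn0 : (0 : ℝ) < n := by linarith
  have hω := hyperplaneBallVolume_pos n
  set C : ℝ := 1 / c₀ * 4 ^ p * (n * ((1 / R) ^ (n - 1) * hyperplaneBallVolume n * (1 / 8)))
    with hC
  have hCp : 0 < C := by positivity
  have hm : p + n - 1 < 0 := by linarith
  -- The bound R/8 keeps the cylinder used below inside the shell 1/2 ≤ ‖x‖ < 1; the other one makes
  -- C δ^(p+n-1) at least 2B.
  set δ : ℝ := min (R / 8) ((2 * B / C) ^ (p + n - 1)⁻¹) with hδdef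
  have hδ : 0 < δ := lt_min (by positivity) (by positivity)
  have hδR : δ / R ≤ 1 / 8 := by
    rw [div_le_iff₀ hR]
    exact (min_le_left _ _).trans (le_of_eq (by ring))
  have hδC : 2 * B ≤ C * δ ^ (p + n - 1) := by
    rw [← div_le_iff₀' hCp]
    calc 2 * B / C = ((2 * B / C) ^ (p + n - 1)⁻¹) ^ (p + n - 1) :=
          (Real.rpow_inv_rpow (by positivity) hm.ne).symm
      _ ≤ δ ^ (p + n - 1) := Real.rpow_le_rpow_of_nonpos hδ (min_le_right _ _) hm.le
  refine ⟨δ, hδ, fun f hf hfb K hKc h0 hKR hdist => ?_⟩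
  obtain ⟨e, he, heK⟩ := exists_inner_le_of_infDist_frontier_lt hKc h0 hdist
  -- On this thin cylinder around e, ⟨x, y⟩ ≤ (δ/R)·R + (3/4)δ: the transverse part is paid for by
  -- the radius R.
  have hW : ∀ x ∈ (fun z : ((Submodule.span ℝ {e})ᗮ :
      Submodule ℝ (EuclideanSpace ℝ (Fin n))) × ℝ => (z.1 : EuclideanSpace ℝ (Fin n)) + z.2 • e) ''
        (closedBall 0 (δ / R) ×ˢ Icc (5 / 8) (3 / 4)),
      1 / 2 ≤ ‖x‖ ∧ ‖x‖ < 1 ∧ ∀ y ∈ K, inner ℝ x y ≤ 2 * δ := by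
    rintro _ ⟨⟨y, t⟩, ⟨hy, ht⟩, rfl⟩
    have hy' : ‖(y : EuclideanSpace ℝ (Fin n))‖ ≤ δ / R := by simpa using hy
    have h1 : ‖t • e‖ = t := by
      rw [norm_smul, he, mul_one, Real.norm_eq_abs, abs_of_nonneg (by linarith [ht.1])]
    have h2 := norm_add_le (y : EuclideanSpace ℝ (Fin n)) (t • e)
    have h3 := norm_sub_le_norm_add (t • e) (y : EuclideanSpace ℝ (Fin n))
    rw [add_comm (t • e)] at h3
    have ht1 := ht.1
    have ht2 := ht.2
    simp only at ht1 ht2 ⊢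
    refine ⟨by linarith, by linarith, fun x hx => ?_⟩
    rw [inner_add_left, inner_smul_left, RCLike.conj_to_real]
    have h4 : inner ℝ (y : EuclideanSpace ℝ (Fin n)) x ≤ δ / R * R :=
      (real_inner_le_norm _ _).trans
        (mul_le_mul hy' (hKR x hx) (norm_nonneg _) (by positivity))
    rw [div_mul_cancel₀ _ hR.ne'] at h4
    have h5 := heK x hx
    nlinarith
  have hint := le_integral_supportFunction hKR h0 (by linarith : p ≤ 0) hc₀ (by positivity) hf hfb hW
  rw [volume_cylinder hn e he, ENNReal.toReal_mul, ENNReal.toReal_mul, ENNReal.toReal_pow,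
    ENNReal.toReal_ofReal (div_pos hδ hR).le, ENNReal.toReal_ofReal hω.le,
    ENNReal.toReal_ofReal (by norm_num)] at hint
  refine lt_of_lt_of_le (by linarith : B < 2 * B) (hδC.trans (le_trans (le_of_eq ?_) hint))
  have h6 : p + (n : ℝ) - 1 = p + ((n - 1 : ℕ) : ℝ) := by
    rw [Nat.cast_sub (by omega)]
    push_cast
    ring
  rw [h6, Real.rpow_add hδ, Real.rpow_natCast, ← mul_assoc 2 2 δ,
    Real.mul_rpow (by norm_num : (0 : ℝ) ≤ 2 * 2) hδ.le, hC, div_pow, div_pow, one_pow]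
  norm_num
  ring

/-! ### Ellipsoids and eccentricity -/

namespace Ellipsoid

variable {n : ℕ} (E : Ellipsoid n)

theorem abs_inner_le_semiaxis {z : EuclideanSpace ℝ (Fin n)} (hz : z ∈ E.toSet) (i : Fin n) :
    |inner ℝ (E.axes i) (z - E.center)| ≤ E.semiaxis i := by
  have hi := E.semiaxis_pos i
  have h1 : inner ℝ (E.axes i) (z - E.center) ^ 2 / E.semiaxis i ^ 2 ≤ 1 :=
    (Finset.single_le_sum (f := fun i => inner ℝ (E.axes i) (z - E.center) ^ 2 /
      E.semiaxis i ^ 2) (fun j _ => by positivity) (Finset.mem_univ i)).trans hz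
  rw [div_le_one (by positivity)] at h1
  exact abs_le_of_sq_le_sq h1 hi.le

/-- The diameter of the ball parallel to the i-th axis has length 2ρ, and the ellipsoid has extent
2aᵢ in that direction. -/
theorem le_semiaxis {z : EuclideanSpace ℝ (Fin n)} {ρ : ℝ} (hρ : 0 ≤ ρ)
    (hz : closedBall z ρ ⊆ E.toSet) (i : Fin n) : ρ ≤ E.semiaxis i := by
  have hE : ‖E.axes i‖ = 1 := E.axes.norm_eq_one i
  have h1 := E.abs_inner_le_semiaxis (z := z + ρ • E.axes i)
    (hz (by simp [norm_smul, abs_of_nonneg hρ])) i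
  have h2 := E.abs_inner_le_semiaxis (z := z - ρ • E.axes i)
    (hz (by simp [norm_smul, abs_of_nonneg hρ])) i
  rw [add_sub_right_comm, inner_add_right, inner_smul_right, real_inner_self_eq_norm_sq, hE] at h1
  rw [sub_right_comm, inner_sub_right, inner_smul_right, real_inner_self_eq_norm_sq, hE] at h2
  linarith [(abs_le.1 h1).2, (abs_le.1 h2).1]

/-- The box with half-sides aᵢ/n along the axes is inscribed: each term of the defining sum is at
most 1/n² ≤ 1/n. -/
theorem prod_semiaxis_le_volume (hn : n ≠ 0) :
    ENNReal.ofReal (∏ i, (2 / n * E.semiaxis i)) ≤ volume E.toSet := by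
  have hn0 : (0 : ℝ) < n := by exact_mod_cast Nat.pos_of_ne_zero hn
  have hn1 : (1 : ℝ) ≤ n := by exact_mod_cast Nat.one_le_iff_ne_zero.2 hn
  set Q : Set (EuclideanSpace ℝ (Fin n)) :=
    {x | ∀ i, x i ∈ Icc (-(E.semiaxis i / n)) (E.semiaxis i / n)} with hQ
  have hQm : MeasurableSet Q := by
    rw [hQ, ofPred_forall]
    exact (isClosed_iInter fun i => isClosed_Icc.preimage (by fun_prop)).measurableSet
  have hsub : (fun x => E.center + x) '' (E.axes.repr ⁻¹' Q) ⊆ E.toSet := by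
    rintro _ ⟨x, hx, rfl⟩
    simp only [toSet, mem_ofPred_eq, add_sub_cancel_left]
    calc ∑ i, inner ℝ (E.axes i) x ^ 2 / E.semiaxis i ^ 2 ≤ ∑ _i : Fin n, 1 / (n : ℝ) := by
          refine Finset.sum_le_sum fun i _ => ?_
          have hi := E.semiaxis_pos i
          have h1 := hx i
          rw [OrthonormalBasis.repr_apply_apply, mem_Icc, ← abs_le] at h1
          rw [div_le_iff₀ (by positivity), ← sq_abs]
          calc |inner ℝ (E.axes i) x| ^ 2 ≤ (E.semiaxis i / n) ^ 2 := by gcongr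
            _ = 1 / n * (1 / n) * E.semiaxis i ^ 2 := by ring
            _ ≤ 1 / n * 1 * E.semiaxis i ^ 2 := by
              gcongr
              rwa [div_le_one hn0]
            _ = _ := by ring
      _ = 1 := by simp [hn0.ne']
  refine le_trans (le_of_eq ?_) (measure_mono hsub)
  rw [image_add_left, measure_preimage_add,
    E.axes.measurePreserving_repr.measure_preimage hQm.nullMeasurableSet, hQ,
    volume_euclidean_pi_Icc, ENNReal.ofReal_prod_of_nonneg]
  · congr 1
    ext1 i
    congr 1
    ring
  · intro i _
    have := E.semiaxis_pos i
    positivity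

/-- A ball as an ellipsoid. -/
noncomputable def ofRadius (n : ℕ) {R : ℝ} (hR : 0 < R) : Ellipsoid n where
  center := 0
  axes := EuclideanSpace.basisFun (Fin n) ℝ
  semiaxis := fun _ => R
  semiaxis_pos := fun _ => hR

theorem toSet_ofRadius {R : ℝ} (hR : 0 < R) : (ofRadius n hR).toSet = closedBall 0 R := by
  ext x
  simp only [toSet, ofRadius, EuclideanSpace.basisFun_inner, sub_zero, mem_ofPred_eq,
    mem_closedBall_zero_iff]
  rw [← Finset.sum_div, div_le_one (by positivity), ← abs_of_pos hR, sq_abs, ← sq_le_sq₀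
    (norm_nonneg _) (abs_nonneg _), EuclideanSpace.norm_sq_eq, sq_abs]
  simp

end Ellipsoid

/-- A body squeezed between two balls has bounded eccentricity. -/
theorem eccentricity_le {n : ℕ} (hn : 2 ≤ n) {K : Set (EuclideanSpace ℝ (Fin n))} {ρ R : ℝ}
    (hρ : 0 < ρ) (hR : 0 < R) {z : EuclideanSpace ℝ (Fin n)} (hz : closedBall z ρ ⊆ K)
    (hKR : ∀ x ∈ K, ‖x‖ ≤ R) :
    eccentricity K ≤ (volume (closedBall (0 : EuclideanSpace ℝ (Fin n)) R)).toReal /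
      ((2 / n) ^ n * ρ ^ (n - 1)) / ρ := by
  have hn0 : (0 : ℝ) < n := by exact_mod_cast (by omega : 0 < n)
  have : Nonempty (Fin n) := ⟨⟨0, by omega⟩⟩
  -- The bound is nonnegative and holds for every minimum ellipsoid, so neither existence nor
  -- uniqueness is needed.
  refine Real.sSup_le ?_ (by positivity)
  rintro _ ⟨E, ⟨hKE, hmin⟩, rfl⟩
  have hρE : ∀ i, ρ ≤ E.semiaxis i := E.le_semiaxis hρ.le (hz.trans hKE)
  have h1 := hmin (Ellipsoid.ofRadius n hR) (by
    rw [Ellipsoid.toSet_ofRadius]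
    intro x hx
    simpa using hKR x hx)
  rw [Ellipsoid.toSet_ofRadius] at h1
  have h2 := ENNReal.toReal_mono measure_closedBall_lt_top.ne
    ((E.prod_semiaxis_le_volume (by omega)).trans h1)
  rw [ENNReal.toReal_ofReal (Finset.prod_nonneg fun i _ => by
    have := E.semiaxis_pos i
    positivity), Finset.prod_mul_distrib, Finset.prod_const, Finset.card_univ,
    Fintype.card_fin] at h2
  -- The product of the semi-axes is controlled by the volume of the competing ball of radius R, and
  -- all other factors are at least ρ.
  have h3 : ∀ i, E.semiaxis i ≤ (volume (closedBall (0 : EuclideanSpace ℝ (Fin n)) R)).toReal /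
      ((2 / n) ^ n * ρ ^ (n - 1)) := by
    intro i
    rw [le_div_iff₀ (by positivity)]
    refine le_trans ?_ h2
    rw [← Finset.mul_prod_erase _ _ (Finset.mem_univ i)]
    have h4 : ρ ^ (n - 1) ≤ ∏ j ∈ Finset.univ.erase i, E.semiaxis j := by
      calc ρ ^ (n - 1) = ∏ _j ∈ Finset.univ.erase i, ρ := by
            rw [Finset.prod_const, Finset.card_erase_of_mem (Finset.mem_univ i),
              Finset.card_univ, Fintype.card_fin]
        _ ≤ _ := Finset.prod_le_prod (fun _ _ => hρ.le) fun j _ => hρE j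
    have hi := E.semiaxis_pos i
    calc E.semiaxis i * ((2 / n) ^ n * ρ ^ (n - 1)) =
          (2 / n) ^ n * (E.semiaxis i * ρ ^ (n - 1)) := by ring
      _ ≤ _ := by gcongr
  exact div_le_div₀ (by positivity) (ciSup_le h3) hρ (le_ciInf hρE)

/-! ### Conclusion -/

/-- A bound for the functional keeps the origin away from the boundary and confines a convex body
between two balls. -/
theorem exists_confinement {n : ℕ} (hn : 2 ≤ n) {p q c₀ : ℝ} (A : ℝ) (hq : 0 ≤ q)
    (hp : p < -(n : ℝ) - q + 1) (hc₀ : 0 < c₀) :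
    ∃ δ ρ R : ℝ, 0 < δ ∧ 0 < ρ ∧ 0 < R ∧
      ∀ f : sphere (0 : EuclideanSpace ℝ (Fin n)) 1 → ℝ, AEMeasurable f (sphereMeasure n) →
      (∀ᵐ u ∂(sphereMeasure n), 1 / c₀ ≤ f u ∧ f u ≤ c₀) →
      ∀ K : Set (EuclideanSpace ℝ (Fin n)), IsCompact K → Convex ℝ K → 0 ∈ interior K →
      functionalJ p q f K ≤ A →
      infDist 0 (frontier K) ∉ Ioo 0 δ ∧ (∃ z, closedBall z ρ ⊆ K) ∧ ∀ x ∈ K, ‖x‖ ≤ R := by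
  have hn2 : (2 : ℝ) ≤ n := by exact_mod_cast hn
  have hp0 : p < 0 := by linarith
  -- With X the integral term, I_q - X/p ≤ A gives I_q ≤ |A| and X ≤ -p|A|. This B dominates both,
  -- and the +1 makes it positive.
  set B : ℝ := (|A| + 1) * (1 - p) with hB
  have hA := abs_nonneg A
  have hBp : 0 < B := by
    have : 0 < 1 - p := by linarith
    positivity
  obtain ⟨ρ, R, hρ, hR, hrad⟩ := exists_radii hn hq hp hc₀ hBp
  obtain ⟨δ, hδ, hdist⟩ := exists_lt_integral_of_infDist hn (p := p) (by linarith) hc₀ hR hBp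
  refine ⟨δ, ρ, R, hδ, hρ, hR, fun f hf hfb K hK hKc h0 hJ => ?_⟩
  obtain ⟨R', hR'⟩ := hK.isBounded.exists_norm_le
  have hX : 0 ≤ ∫ u, f u * supportFunction K (u : EuclideanSpace ℝ (Fin n)) ^ p
      ∂(sphereMeasure n) := by
    -- Taking W empty turns the lower bound into nonnegativity.
    simpa using le_integral_supportFunction (M := 1) (W := ∅) hR' h0 hp0.le hc₀ one_pos hf hfb (by simp)
  unfold functionalJ at hJ
  set X := ∫ u, f u * supportFunction K (u : EuclideanSpace ℝ (Fin n)) ^ p ∂(sphereMeasure n)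
  have hI : 0 ≤ (chordIntegral q K).toReal := ENNReal.toReal_nonneg
  have hp' : 1 / p * X ≤ 0 := mul_nonpos_of_nonpos_of_nonneg (one_div_neg.2 hp0).le hX
  have hIB : (chordIntegral q K).toReal ≤ B := by
    nlinarith [le_abs_self A]
  have hXB : X ≤ B := by
    have h1 : X = -p * (-(1 / p * X)) := by
      have := hp0.ne
      field_simp
    have h2 : -(1 / p * X) ≤ |A| := by linarith [le_abs_self A]
    rw [h1]
    calc -p * (-(1 / p * X)) ≤ -p * |A| := mul_le_mul_of_nonneg_left h2 (by linarith)
      _ ≤ B := by nlinarith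
  obtain ⟨hz, hKR⟩ := hrad f hf hfb K hK hKc h0 hIB hXB
  exact ⟨fun hd => (hdist f hf hfb K hKc h0 hKR hd).not_ge hXB, hz, hKR⟩

end ChordMinkowski

theorem lemma4p2 (n : ℕ) (hn : 2 ≤ n) (p q c₀ A : ℝ) (hq : 0 ≤ q)
    (hp : p < -(n : ℝ) - q + 1) (hc₀ : 1 ≤ c₀) :
    ∃ δ v₀ v₁ ebar : ℝ, 0 < δ ∧ 0 < v₀ ∧ 0 < v₁ ∧ 0 < ebar ∧
      ∀ f : Metric.sphere (0 : EuclideanSpace ℝ (Fin n)) 1 → ℝ,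
        AEMeasurable f (ChordMinkowski.sphereMeasure n) →
        (∀ᵐ u ∂(ChordMinkowski.sphereMeasure n), 1 / c₀ ≤ f u ∧ f u ≤ c₀) →
        ∀ Ω : ConvexBody (EuclideanSpace ℝ (Fin n)),
          (0 : EuclideanSpace ℝ (Fin n)) ∈ interior (Ω : Set (EuclideanSpace ℝ (Fin n))) →
          (Metric.infDist (0 : EuclideanSpace ℝ (Fin n))
                (frontier (Ω : Set (EuclideanSpace ℝ (Fin n)))) ∈ Set.Ioo 0 δ ∨
            v₁ ≤ (volume (Ω : Set (EuclideanSpace ℝ (Fin n)))).toReal ∨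
            (volume (Ω : Set (EuclideanSpace ℝ (Fin n)))).toReal ≤ v₀ ∨
            ebar ≤ ChordMinkowski.eccentricity (Ω : Set (EuclideanSpace ℝ (Fin n)))) →
          A < ChordMinkowski.functionalJ p q f (Ω : Set (EuclideanSpace ℝ (Fin n))) := by
  have hc : 0 < c₀ := by linarith
  obtain ⟨δ, ρ, R, hδ, hρ, hR, hmain⟩ := ChordMinkowski.exists_confinement hn A hq hp hc
  set b := (volume (Metric.ball (0 : EuclideanSpace ℝ (Fin n)) ρ)).toReal with hb
  set V := (volume (Metric.closedBall (0 : EuclideanSpace ℝ (Fin n)) R)).toReal with hV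
  set s := V / ((2 / n) ^ n * ρ ^ (n - 1)) / ρ with hs
  have hV0 : 0 ≤ V := ENNReal.toReal_nonneg
  have hs0 : 0 ≤ s := by positivity
  have hb0 : 0 < b := ENNReal.toReal_pos (Metric.measure_ball_pos _ _ hρ).ne'
    measure_ball_lt_top.ne
  -- The last three alternatives are non-strict, so the thresholds leave a margin beyond the
  -- confinement bounds b, V and s.
  refine ⟨δ, b / 2, V + 1, s + 1, hδ, by positivity, by positivity, by positivity, ?_⟩
  intro f hf hfb Ω h0 hΩ
  by_contra! hJ
  obtain ⟨hd, ⟨z, hz⟩, hKR⟩ := hmain f hf hfb Ω Ω.isCompact Ω.convex h0 hJ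
  rcases hΩ with h | h | h | h
  · exact hd h
  · have h1 : (volume (Ω : Set (EuclideanSpace ℝ (Fin n)))).toReal ≤ V :=
      ENNReal.toReal_mono measure_closedBall_lt_top.ne
        (measure_mono fun x hx => by simpa using hKR x hx)
    linarith
  · have h1 : b ≤ (volume (Ω : Set (EuclideanSpace ℝ (Fin n)))).toReal := by
      rw [hb, ← MeasureTheory.Measure.addHaar_ball_center _ z]
      exact ENNReal.toReal_mono Ω.isCompact.measure_ne_top
        (measure_mono (Metric.ball_subset_closedBall.trans hz))
    linarith
  · have h1 := ChordMinkowski.eccentricity_le hn hρ hR hz hKR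
    linarith
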